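/- **Discrete filtered sets.** A discrete filtered set (d.f.s.) is a family $\Omega=(\Omega_L)_{L\ge 0}$ of finite subsets of $\mathbb C$ with $\Omega_{L_1}\subseteq\Omega_{L_2}$ for $L_1\le L_2$ and $\Omega_r=\emptyset$ for some $r>0$. Put $\rho(\Omega)=\sup\{r\ge0:\Omega_r=\emptyset\}\in(0,\infty]$. The sum is $(\Omega*\Omega')_L=\{\omega_1+\omega_2:\omega_1\in\Omega_{L_1},\ \omega_2\in\Omega'_{L_2},\ L_1+L_2=L\}\cup\Omega_L\cup\Omega'_L$, and $\Omega^{*n}=\Omega*\cdots*\Omega$ ($n$ times). Let $\overline{\mathcal S}_\Omega$ be the closure of $\{(\lambda,\omega):\lambda\ge 0,\ \omega\in\Omega_\lambda\}$ in $\mathbb R_{\ge0}\times\mathbb C$, with the Euclidean distance of $\mathbb R\times\mathbb C\simeq\mathbb R^3$. **Allowed paths and endless surfaces.** For a Lipschitz path $\gamma:[0,1]\to\mathbb C$ with $\gamma(0)=0$, let $L(\gamma|_t)$ be the length of $\gamma|_{[0,t]}$ and $\tilde\gamma(t)=(L(\gamma|_t),\gamma(t))$. The path is $\Omega$-allowed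 if $\tilde\gamma(t)\notin\overline{\mathcal S}_\Omega$ for all $t\in[0,1]$. Let $\Pi_\Omega^{\delta,L}$ be the set of $\Omega$-allowed paths with $\operatorname{dist}(\tilde\gamma(t),\overline{\mathcal S}_\Omega)\ge\delta$ and $L(\gamma|_t)\le L$ for all $t\in[0,1]$ (the distance to $\emptyset$ is $+\infty$). An $\Omega$-endless Riemann surface $(X,\mathfrak p,\underline0)$ is a connected Riemann surface $X$ with a local biholomorphism $\mathfrak p:X\to\mathbb C$ and a point $\underline0\in\mathfrak p^{-1}(0)$ such that every $\Omega$-allowed path $\gamma$ has a lift $\underline\gamma$ to $X$ with $\underline\gamma(0)=\underline0$. Put $K^{\delta,L}=\{\underline\gamma(1):\gamma\in\Pi_\Omega^{\delta,L}\}\subset X$, and, for $|\xi|<\rho(\Omega)$, let $\mathscr L(\xi)\in X$ be the end point of the lift of $t\in[0,1]\mapsto t\xi$. **Iteration diagrams.** An iteration diagram $T=(V,E)$ is a finite directed tree in which every vertex has at most one outgoing edge. It has a unique vertex $\hat v$, the root, that can be reached from every vertex by a directed path. Put $k=|V|$, $V^\circ=V\setminus\{\hat v\}$, $V_v^1=\{u\in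 V: u\to v\in E\}$; $v$ is a leaf if $V_v^1=\emptyset$; $w_v$ is the number of leaves from which $v$ can be reached (a vertex reaches itself); and $$\Delta_T=\Big\{s\in\mathbb R_{\ge0}^V:\ \sum_{u\in V_v^1}s_u\le s_v\ (v\in V),\ s_{\hat v}=1\Big\}.$$ Let $W_v=\{\hat v\}\cup\bigcup_{v'}V^1_{v'}$, where $v'$ runs over the vertices other than $v$ on the path from $v$ to $\hat v$. **Data.** Let $T$ be an iteration diagram and $\Omega$ a d.f.s., put $\Omega_v=\Omega^{*w_v}$, and for each $v\in V$ let $(X_v,\mathfrak p_v,\underline0_v)$ be an $\Omega_v$-endless Riemann surface (for instance the universal one $X_{\Omega_v}$, the initial object in the category of these surfaces). Write $\mathscr L_v$ and $K_{\Omega_v}^{\delta,L}$ for the above objects on $X_v$. Let $\rho>0$ with $2\rho<\rho(\Omega)$, let $0<\delta\le\rho$, $L>0$, $a\in(0,1)$, and let $\gamma\in\Pi_{\Omega_{\hat v}}^{\delta,L}$ be such that $\gamma|_{[a,1]}$ is $C^1$, $|\gamma(a)|=\rho$ and $\gamma(t)=\gamma(a)a^{-1}t$ on $[0,a]$. Let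 $\underline\gamma$ be the lift of $\gamma$ to $X_{\hat v}$. **Adapted deformations.** A family of maps $\Psi_t:\Delta_T\to\prod_{v\in V}X_v$ ($t\in[a,1]$), with components $\underline\xi^t_v$, is a $(\gamma,T)$-adapted deformation of $\mathscr D(\gamma(a))$ if 1. $\Psi_a(s)=\mathscr D(\gamma(a),s):=(\mathscr L_v(s_v\gamma(a)))_{v\in V}$ for all $s\in\Delta_T$; 2. $(t,s)\mapsto\Psi_t(s)$ is locally Lipschitz on $[a,1]\times\Delta_T$; 3. $\underline\xi_v^t(s)$ depends only on the variables $s_u$ with $u\in W_v$; 4. $\underline\xi_{\hat v}^t(s)=\underline\gamma(t)$ for all $t\in[a,1]$, $s\in\Delta_T$; 5. for $v\in V^\circ$, $s_v=0$ implies $\underline\xi_v^t(s)=\underline0_v$; 6. for every non-leaf $v$, $\sum_{u\in V_v^1}s_u=s_v$ implies $\sum_{u\in V_v^1}\mathfrak p_u(\underline\xi_u^t(s))=\mathfrak p_v(\underline\xi_v^t(s))$. **Theorem 4.6.** There exists a $(\gamma,T)$-adapted deformation $(\Psi_t)_{t\in[a,1]}$ of $\mathscr D(\gamma(a))$ such that,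 for every $t\in[a,1]$, $$\Psi_t(\Delta_T)\subset\bigcup_{s\in\Delta_T}\ \prod_{v\in V}K_{\Omega_v}^{\delta'(t),\,s_vL(\gamma|_t)},$$ and, with $\xi_v^t=\mathfrak p_v\circ\underline\xi_v^t$, the partial derivatives $\partial\xi_v^t/\partial s_u$ ($u,v\in V^\circ$) exist almost everywhere on $\Delta_T$ (for Lebesgue measure in the coordinates $(s_u)_{u\in V^\circ}$) and satisfy there $$\Big|\det\Big[\frac{\partial\xi_v^t}{\partial s_u}\Big]_{u,v\in V^\circ}\Big|\le c(t)^{k-1},$$ where $$\delta'(t)=\rho\,e^{-2\sqrt2\,\delta^{-1}L_a(\gamma|_t)},\qquad c(t)=\rho\,e^{3\delta^{-1}L_a(\gamma|_t)},\qquad L_a(\gamma|_t)=\int_a^t|\gamma'(t')|\,dt'.$$ -/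

import Mathlib

open scoped NNReal ENNReal Manifold ContDiff

universe u

/-! ## Discrete filtered sets -/

/-- A discrete filtered set (d.f.s.): a family `Ω_L`, `L ≥ 0`, of finite subsets of `ℂ`, increasing
in `L`, with `Ω_δ = ∅` for some `δ > 0`. -/
structure DFS where
  set : ℝ≥0 → Set ℂ
  finite' : ∀ L, (set L).Finite
  mono' : Monotone set
  exists_empty' : ∃ δ : ℝ≥0, 0 < δ ∧ set δ = ∅

namespace DFS

/-- The trivial d.f.s. -/
def trivial : DFS where
  set := fun _ => ∅
  finite' := fun _ => Set.finite_empty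
  mono' := fun _ _ _ => le_rfl
  exists_empty' := ⟨1, one_pos, rfl⟩

/-- The sum `Ω * Ω'` of two d.f.s. -/
def conv (Ω Ω' : DFS) : DFS where
  set := fun L =>
    {z | ∃ L₁ L₂ : ℝ≥0, L₁ + L₂ = L ∧ ∃ w₁ ∈ Ω.set L₁, ∃ w₂ ∈ Ω'.set L₂, w₁ + w₂ = z}
      ∪ Ω.set L ∪ Ω'.set L
  finite' := by
    intro L
    refine ((Set.Finite.subset ((Ω.finite' L).image2 (fun x y => x + y) (Ω'.finite' L)) ?_).union
      (Ω.finite' L)).union (Ω'.finite' L)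
    rintro z ⟨L₁, L₂, h, w₁, h₁, w₂, h₂, rfl⟩
    exact ⟨w₁, Ω.mono' (h ▸ le_self_add) h₁, w₂, Ω'.mono' (h ▸ le_add_self) h₂, rfl⟩
  mono' := by
    intro L L' hL
    refine Set.union_subset_union (Set.union_subset_union ?_ (Ω.mono' hL)) (Ω'.mono' hL)
    rintro z ⟨L₁, L₂, h, w₁, h₁, w₂, h₂, rfl⟩
    refine ⟨L₁, L₂ + (L' - L), ?_, w₁, h₁, w₂, Ω'.mono' le_self_add h₂, rfl⟩
    rw [← add_assoc, h, add_tsub_cancel_of_le hL]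
  exists_empty' := by
    obtain ⟨d, hd, hΩ⟩ := Ω.exists_empty'
    obtain ⟨d', hd', hΩ'⟩ := Ω'.exists_empty'
    have h1 : ∀ L ≤ min d d', Ω.set L = ∅ := fun L hL =>
      Set.subset_empty_iff.1 (hΩ ▸ Ω.mono' (hL.trans (min_le_left _ _)))
    have h2 : ∀ L ≤ min d d', Ω'.set L = ∅ := fun L hL =>
      Set.subset_empty_iff.1 (hΩ' ▸ Ω'.mono' (hL.trans (min_le_right _ _)))
    refine ⟨min d d', lt_min hd hd', ?_⟩
    rw [h1 _ le_rfl, h2 _ le_rfl, Set.union_empty, Set.union_empty, Set.eq_empty_iff_forall_notMem]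
    rintro z ⟨L₁, L₂, h, w₁, hw, -⟩
    rw [h1 L₁ (h ▸ le_self_add)] at hw
    exact hw

/-- `Ω^{*n} = Ω * ⋯ * Ω` (`n` times); the value at `n = 0` is the unit `∅` of the sum, so that
`Ω^{*1} = Ω`. -/
def convPow (Ω : DFS) : ℕ → DFS
  | 0 => trivial
  | n + 1 => conv (convPow Ω n) Ω

lemma convPow_one (Ω : DFS) : Ω.convPow 1 = Ω := by
  cases Ω
  simp [convPow, conv, trivial]

/-- The distance `ρ(Ω) = sup {ρ ≥ 0 | Ω_ρ = ∅}`, in `[0, ∞]` (it is `∞` if and only if `Ω` is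
trivial). -/
noncomputable def rho (Ω : DFS) : ℝ≥0∞ := ⨆ (r : ℝ≥0) (_ : Ω.set r = ∅), (r : ℝ≥0∞)

/-- `𝒮_Ω = {(λ, w) | λ ≥ 0, w ∈ Ω_λ}` as a subset of `ℝ × ℂ` with its Euclidean (`ℓ²`) distance. -/
def singSet (Ω : DFS) : Set (WithLp 2 (ℝ × ℂ)) :=
  {z | ∃ l : ℝ≥0, ∃ w ∈ Ω.set l, z = WithLp.toLp 2 ((l : ℝ), w)}

end DFS

/-! ## Paths -/

/-- The length `L(γ|_t)` of the restriction of `γ` to `[0, t]`. -/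
noncomputable def pathLength (γ : ℝ → ℂ) (t : ℝ) : ℝ := (eVariationOn γ (Set.Icc 0 t)).toReal

/-- `γ̃(t) = (L(γ|_t), γ(t))`. -/
noncomputable def liftedPoint (γ : ℝ → ℂ) (t : ℝ) : WithLp 2 (ℝ × ℂ) :=
  WithLp.toLp 2 (pathLength γ t, γ t)

/-- `L_a(γ|_t) = ∫_a^t |γ'|`. -/
noncomputable def lengthFrom (γ : ℝ → ℂ) (a t : ℝ) : ℝ := ∫ τ in a..t, ‖deriv γ τ‖

/-- `Π`: Lipschitz paths `γ : [0,1] → ℂ` with `γ(0) = 0`. A path is represented by a function on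
`ℝ` of which only the restriction to `[0,1]` matters. -/
def IsLipPath (γ : ℝ → ℂ) : Prop :=
  (∃ K : ℝ≥0, LipschitzOnWith K γ (Set.Icc 0 1)) ∧ γ 0 = 0

namespace DFS

/-- `Π_Ω`: the `Ω`-allowed paths, i.e. `γ̃(t) ∈ ℳ_Ω` (the complement of the closure of `𝒮_Ω`) for
all `t ∈ [0,1]`. -/
def allowedPaths (Ω : DFS) : Set (ℝ → ℂ) :=
  {γ | IsLipPath γ ∧ ∀ t ∈ Set.Icc (0 : ℝ) 1, liftedPoint γ t ∉ closure Ω.singSet}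

/-- `Π_Ω^{δ,L}`: the `Ω`-allowed paths with `dist(γ̃(t), closure 𝒮_Ω) ≥ δ` and `L(γ|_t) ≤ L` for all
`t ∈ [0,1]`. The distance to the empty set is `∞`. -/
def allowedPathsIn (Ω : DFS) (δ L : ℝ) : Set (ℝ → ℂ) :=
  {γ | γ ∈ Ω.allowedPaths ∧ ∀ t ∈ Set.Icc (0 : ℝ) 1,
    ENNReal.ofReal δ ≤ Metric.infEDist (liftedPoint γ t) (closure Ω.singSet) ∧ pathLength γ t ≤ L}

end DFS

/-! ## Endless Riemann surfaces -/

/-- An `Ω`-endless Riemann surface `(X, 𝔭, 0)`: a connected Riemann surface `X` with a local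
biholomorphism `𝔭 : X → ℂ` and a point `0 ∈ 𝔭⁻¹(0)` such that every `Ω`-allowed path has a lift
to `X` that starts at this point. -/
structure EndlessSurface (Ω : DFS) where
  carrier : Type u
  [topology : TopologicalSpace carrier]
  [t2 : T2Space carrier]
  [connected : ConnectedSpace carrier]
  [charted : ChartedSpace ℂ carrier]
  [manifold : IsManifold 𝓘(ℂ) ω carrier]
  proj : carrier → ℂ
  proj_local : IsLocalDiffeomorph 𝓘(ℂ) 𝓘(ℂ) ω proj
  base : carrier
  proj_base : proj base = 0
  exists_lift : ∀ γ ∈ Ω.allowedPaths, ∃ g : ℝ → carrier,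
    ContinuousOn g (Set.Icc 0 1) ∧ g 0 = base ∧ ∀ t ∈ Set.Icc (0 : ℝ) 1, proj (g t) = γ t

attribute [instance] EndlessSurface.topology EndlessSurface.t2 EndlessSurface.connected
  EndlessSurface.charted EndlessSurface.manifold

namespace EndlessSurface

variable {Ω : DFS} (X : EndlessSurface Ω)

open scoped Classical in
/-- The lift of an `Ω`-allowed path `γ` that starts at the base point (on `[0,1]` it is unique, as
`X` is Hausdorff and `proj` is a local homeomorphism; see `lift_spec` and `lift_unique`). -/
noncomputable def lift (γ : ℝ → ℂ) : ℝ → X.carrier :=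
  if h : γ ∈ Ω.allowedPaths then Classical.choose (X.exists_lift γ h) else fun _ => X.base

lemma lift_spec {γ : ℝ → ℂ} (h : γ ∈ Ω.allowedPaths) :
    ContinuousOn (X.lift γ) (Set.Icc 0 1) ∧ X.lift γ 0 = X.base ∧
      ∀ t ∈ Set.Icc (0 : ℝ) 1, X.proj (X.lift γ t) = γ t := by
  rw [lift, dif_pos h]
  exact Classical.choose_spec (X.exists_lift γ h)

lemma lift_unique {γ : ℝ → ℂ} (h : γ ∈ Ω.allowedPaths) {g : ℝ → X.carrier}
    (hc : ContinuousOn g (Set.Icc 0 1)) (h0 : g 0 = X.base)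
    (hp : ∀ t ∈ Set.Icc (0 : ℝ) 1, X.proj (g t) = γ t) :
    Set.EqOn g (X.lift γ) (Set.Icc 0 1) := by
  obtain ⟨hc', h0', hp'⟩ := X.lift_spec h
  have hinj : IsLocallyInjective X.proj := X.proj_local.isLocalHomeomorph.isLocallyInjective
  have hsep : IsSeparatedMap X.proj := T2Space.isSeparatedMap _
  exact hsep.eqOn_of_comp_eqOn hinj isPreconnected_Icc hc hc'
    (fun t ht => (hp t ht).trans (hp' t ht).symm)
    (Set.left_mem_Icc.2 zero_le_one) (h0.trans h0'.symm)

/-- `ℒ(ξ)`, the end point of the lift of the segment `t ↦ t ξ` (used for `|ξ| < ρ(Ω)`). -/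
noncomputable def radial (ξ : ℂ) : X.carrier := X.lift (fun t : ℝ => (t : ℂ) * ξ) 1

/-- `K^{δ,L}`: the end points of the lifts of the paths of `Π_Ω^{δ,L}`. -/
def compactum (δ L : ℝ) : Set X.carrier := {x | ∃ γ ∈ Ω.allowedPathsIn δ L, X.lift γ 1 = x}

end EndlessSurface

/-! ## Iteration diagrams -/

/-- An iteration diagram on the vertex set `V`: a directed tree (an orientation of a tree) in which
every vertex has at most one outgoing edge. `edge u v` means `u → v`. -/
structure IterationDiagram (V : Type*) where
  edge : V → V → Prop
  asymm' : ∀ u v, edge u v → ¬ edge v u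
  isTree : (SimpleGraph.fromRel edge).IsTree
  out_unique : ∀ v u u', edge v u → edge v u' → u = u'

namespace IterationDiagram

variable {V : Type*} [Fintype V] (T : IterationDiagram V)

lemma exists_sink : ∃ r, ∀ u, ¬ T.edge r u := by
  classical
  by_contra! h
  choose f hf using h
  have hmem : ∀ v, s(v, f v) ∈ (SimpleGraph.fromRel T.edge).edgeFinset := by
    intro v
    rw [SimpleGraph.mem_edgeFinset, SimpleGraph.mem_edgeSet, SimpleGraph.fromRel_adj]
    refine ⟨fun h => ?_, Or.inl (hf v)⟩
    have h2 := hf v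
    rw [← h] at h2
    exact T.asymm' _ _ h2 h2
  have hinj : Function.Injective (fun v => s(v, f v)) := by
    intro v w h
    rcases Sym2.eq_iff.1 h with h | h
    · exact h.1
    · exfalso
      have h1 := hf v
      have h2 := hf w
      rw [h.2] at h1
      rw [← h.1] at h2
      exact T.asymm' _ _ h1 h2
  have h1 := Finset.card_le_card_of_injOn (s := Finset.univ) _ (fun v _ => hmem v) hinj.injOn
  have h2 := T.isTree.card_edgeFinset
  rw [Finset.card_univ] at h1
  omega

lemma exists_root : ∃ r, ∀ v, Relation.ReflTransGen T.edge v r := by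
  obtain ⟨r, hr⟩ := T.exists_sink
  refine ⟨r, fun v => ?_⟩
  obtain ⟨p⟩ := T.isTree.connected.preconnected v r
  induction p with
  | nil => exact .refl
  | @cons v w r hadj _ ih =>
    have hw := ih hr
    rcases (SimpleGraph.fromRel_adj _ _ _).1 hadj with ⟨-, h | h⟩
    · exact .head h hw
    · rcases Relation.ReflTransGen.cases_head hw with h0 | ⟨w', h0, h1⟩
      · exact absurd h (h0 ▸ hr v)
      · rwa [T.out_unique w v w' h h0]

/-- The root: the vertex that can be reached from every vertex (unique by `root_unique`). -/
noncomputable def root : V := Classical.choose T.exists_root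

lemma root_spec (v : V) : Relation.ReflTransGen T.edge v T.root :=
  Classical.choose_spec T.exists_root v

lemma root_unique {r : V} (h : ∀ v, Relation.ReflTransGen T.edge v r) : r = T.root := by
  obtain ⟨x, hx⟩ := T.exists_sink
  have key : ∀ y, Relation.ReflTransGen T.edge x y → x = y := by
    intro y hy
    rcases Relation.ReflTransGen.cases_head hy with h0 | ⟨z, hz, -⟩
    · exact h0
    · exact absurd hz (hx z)
  exact (key r (h x)).symm.trans (key _ (T.root_spec x))

open scoped Classical in
/-- `V_v^1`: the set of vertices `u` with an edge `u → v`. -/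
noncomputable def children (v : V) : Finset V := Finset.univ.filter fun u => T.edge u v

/-- `v` is a leaf if no edge ends at `v`. -/
def IsLeaf (v : V) : Prop := ∀ u, ¬ T.edge u v

/-- The weight `w_v`: the number of leaves from which there is a (possibly trivial) directed path
to `v`. -/
noncomputable def weight (v : V) : ℕ :=
  {l : V | T.IsLeaf l ∧ Relation.ReflTransGen T.edge l v}.ncard

/-- `W_v = {root} ∪ ⋃ V_{v'}^1`, the union over the vertices `v'` on the path from the successor of
`v` to the root, i.e. over the `v'` that can be reached from `v` by a nontrivial directed path. -/
def depSet (v : V) : Set V :=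
  {T.root} ∪ {u | ∃ v', Relation.TransGen T.edge v v' ∧ T.edge u v'}

/-- `Δ_T`. -/
def simplex : Set (V → ℝ) :=
  {s | (∀ v, 0 ≤ s v) ∧ (∀ v, ∑ u ∈ T.children v, s u ≤ s v) ∧ s T.root = 1}

/-- `V° = V ∖ {root}`. -/
abbrev Inner : Type _ := {v : V // v ≠ T.root}

open scoped Classical in
/-- The point of `{s | s_root = 1}` with the coordinates `x` on `V°`; the coordinates on `V°`
identify `Δ_T` with a subset of `ℝ^{V°}`. -/
noncomputable def extend (x : T.Inner → ℝ) : V → ℝ := fun v => if h : v = T.root then 1 else x ⟨v, h⟩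

/-- `Ω_v = Ω^{*w_v}`. -/
noncomputable def dfsAt (Ω : DFS) (v : V) : DFS := Ω.convPow (T.weight v)

end IterationDiagram

/-! ## Adapted deformations -/

/-- `(Ψ_t)_{t ∈ [a,1]}` is a `(γ,T)`-adapted deformation of `𝒟(γ(a))` in `∏_v X_v`. Only the values
`Ψ t s` with `t ∈ [a,1]` and `s ∈ Δ_T` matter. Since the maps `𝔭_v` are local coordinates on the
`X_v`, a map to `∏_v X_v` is locally Lipschitz if and only if it is continuous and its composition
with each `𝔭_v` is locally Lipschitz. -/
structure IsAdaptedDeformation {V : Type*} [Fintype V] (Ω : DFS) (T : IterationDiagram V)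
    (X : ∀ v, EndlessSurface.{u} (T.dfsAt Ω v)) (γ : ℝ → ℂ) (a : ℝ)
    (Ψ : ℝ → (V → ℝ) → ∀ v, (X v).carrier) : Prop where
  initial : ∀ s ∈ T.simplex, ∀ v, Ψ a s v = (X v).radial ((s v : ℂ) * γ a)
  continuousOn : ContinuousOn (fun q : ℝ × (V → ℝ) => Ψ q.1 q.2) (Set.Icc a 1 ×ˢ T.simplex)
  locallyLipschitz : ∀ v, LocallyLipschitzOn (Set.Icc a 1 ×ˢ T.simplex)
    (fun q : ℝ × (V → ℝ) => (X v).proj (Ψ q.1 q.2 v))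
  dependsOn : ∀ t ∈ Set.Icc a 1, ∀ v, ∀ s ∈ T.simplex, ∀ s' ∈ T.simplex,
    (∀ u ∈ T.depSet v, s u = s' u) → Ψ t s v = Ψ t s' v
  root : ∀ t ∈ Set.Icc a 1, ∀ s ∈ T.simplex, Ψ t s T.root = (X T.root).lift γ t
  face_zero : ∀ t ∈ Set.Icc a 1, ∀ v, v ≠ T.root → ∀ s ∈ T.simplex, s v = 0 →
    Ψ t s v = (X v).base
  face_sum : ∀ t ∈ Set.Icc a 1, ∀ v, ¬ T.IsLeaf v → ∀ s ∈ T.simplex,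
    ∑ u ∈ T.children v, s u = s v →
      ∑ u ∈ T.children v, (X u).proj (Ψ t s u) = (X v).proj (Ψ t s v)

/-! Every vertex is moved in `ℝ × ℂ` instead of `ℂ`: the point `ζ_v` starts at `s_v (ρ, γ(a))` and
solves `ζ_v' = g_v(ζ) (|γ'|, γ')` with a factor `g_v ∈ [0,1]`. Preceded by a radial segment, its
second coordinate traces a path whose length is the first coordinate. So `ζ_v` itself is the point
whose distance to `𝒮_{Ω_v}` decides whether the path is allowed, and the deformation consists of the
lifts of these paths.

Let `η_v` be the Euclidean distance of `ζ_v` to `{0} ∪ 𝒮_{Ω_v}`, replaced by the constant `δ` at the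
root. The factors (`speed`) are `1` at the root and `g_u = g_v η_u / max(∑ η_{u'}, η_v)` for a child
`u` of `v`, where `u'` runs over the children of `v`. Three properties carry the proof.

Avoidance: `g_v ≤ η_v / δ` (`speed_le_height`). By Grönwall, the distance to each singular point
decays at most exponentially in the length (`mul_exp_le_norm_sub`), and a non-root vertex that
starts at `0` stays there (`eq_zero`).

Faces: `{0} ∪ 𝒮_{Ω_v}` is the Minkowski sum of the corresponding sets of the children, so `η` is
subadditive (`eta_convPow_sum_le`). Where `∑ ζ_u = ζ_v`, the maximum is therefore the sum and the
factors of the children add up to `g_v`. Nearby the defect is linear (`abs_speed_sub_sum_le`), and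
Grönwall makes the face invariant (`sum_children_eq`). Everywhere the children together are at most
as fast as their parent, which controls the lengths (`sum_fst_le`).

Jacobian: `ζ_v` depends only on `s_u` with `u ∈ W_v`, so the Jacobian is block triangular for the
depth, with one diagonal block for each set of siblings. A Grönwall estimate in the `ℓ¹` norm of the
siblings (`sum_abs_speed_sub_le`) bounds the columns of these blocks, and
`Matrix.norm_det_le_prod_sum_of_level` bounds the determinant by their product. Rademacher's theorem
supplies the derivatives. -/

open Set Filter Topology

/-! ### Grönwall inequalities, upper and lower -/

section Gronwall

variable {E : Type*} [NormedAddCommGroup E] [NormedSpace ℝ E]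

lemma HasDerivWithinAt.Ici_of_Icc {f : ℝ → E} {f' : E} {a b t : ℝ} (ht : t ∈ Ico a b)
    (h : HasDerivWithinAt f f' (Icc a b) t) : HasDerivWithinAt f f' (Ici t) t :=
  (h.mono (Icc_subset_Icc_left ht.1)).mono_of_mem_nhdsWithin (Icc_mem_nhdsGE ht.2)

/-- Grönwall's inequality with a time-dependent rate `k`, of which `P` is a primitive. -/
lemma norm_le_mul_exp_of_norm_deriv_le {Y Y' : ℝ → E} {P k : ℝ → ℝ} {a b : ℝ}
    (hY : ∀ t ∈ Icc a b, HasDerivWithinAt Y (Y' t) (Icc a b) t)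
    (hP : ∀ t ∈ Icc a b, HasDerivWithinAt P (k t) (Icc a b) t)
    (hk : ∀ t ∈ Icc a b, ‖Y' t‖ ≤ k t * ‖Y t‖) {t : ℝ} (ht : t ∈ Icc a b) :
    ‖Y t‖ ≤ ‖Y a‖ * Real.exp (P t - P a) := by
  have hYc : ContinuousOn Y (Icc a b) := fun t ht => (hY t ht).continuousWithinAt
  have hPc : ContinuousOn P (Icc a b) := fun t ht => (hP t ht).continuousWithinAt
  -- The comparison theorem needs a strict inequality of derivatives where the two sides meet.
  -- Enlarging the initial value by `ε` makes the bound positive, and enlarging the rate by `ε` then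
  -- makes the inequality strict.
  have key : ∀ ε > 0, ‖Y t‖ ≤ (‖Y a‖ + ε) * Real.exp (P t - P a + ε * (t - a)) := by
    intro ε hε
    refine image_norm_le_of_norm_deriv_right_lt_deriv_boundary' (a := a) (b := b) (f := Y)
      (f' := Y') hYc (fun x hx => (hY x (Ico_subset_Icc_self hx)).Ici_of_Icc hx)
      (B := fun x => (‖Y a‖ + ε) * Real.exp (P x - P a + ε * (x - a)))
      (B' := fun x => (‖Y a‖ + ε) * (Real.exp (P x - P a + ε * (x - a)) * (k x + ε))) ?_ ?_ ?_ ?_ ht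
    · simp [hε.le]
    · exact continuousOn_const.mul ((hPc.sub continuousOn_const).add (by fun_prop)).rexp
    · intro x hx
      have h1 : HasDerivWithinAt (fun x => P x - P a + ε * (x - a)) (k x + ε) (Ici x) x := by
        have h2 := ((hP x (Ico_subset_Icc_self hx)).Ici_of_Icc hx).sub_const (P a)
        have h3 := (((hasDerivWithinAt_id x (Ici x)).sub_const a).const_mul ε)
        have h4 := h2.add h3
        rw [mul_one] at h4
        exact h4
      exact h1.exp.const_mul _
    · intro x hx hB
      have hpos : 0 < (‖Y a‖ + ε) * Real.exp (P x - P a + ε * (x - a)) := by positivity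
      have := hk x (Ico_subset_Icc_self hx)
      rw [hB] at this
      nlinarith
  have hlim : Tendsto (fun ε : ℝ => (‖Y a‖ + ε) * Real.exp (P t - P a + ε * (t - a))) (𝓝[>] 0)
      (𝓝 (‖Y a‖ * Real.exp (P t - P a))) := by
    have : Continuous (fun ε : ℝ => (‖Y a‖ + ε) * Real.exp (P t - P a + ε * (t - a))) := by
      fun_prop
    have h := this.tendsto 0
    simp only [add_zero, zero_mul] at h
    exact h.mono_left nhdsWithin_le_nhds
  exact ge_of_tendsto hlim (eventually_mem_nhdsWithin.mono fun ε hε => key ε hε)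

/-- The lower bound in Grönwall's inequality. -/
lemma mul_exp_le_norm_of_norm_deriv_le {Y Y' : ℝ → E} {P k : ℝ → ℝ} {a b : ℝ}
    (hY : ∀ t ∈ Icc a b, HasDerivWithinAt Y (Y' t) (Icc a b) t)
    (hP : ∀ t ∈ Icc a b, HasDerivWithinAt P (k t) (Icc a b) t)
    (hk : ∀ t ∈ Icc a b, ‖Y' t‖ ≤ k t * ‖Y t‖) {t : ℝ} (ht : t ∈ Icc a b) :
    ‖Y a‖ * Real.exp (-(P t - P a)) ≤ ‖Y t‖ := by
  -- The reflection `x ↦ a + t - x` reverses time and turns the upper bound into the lower one; the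
  -- primitive changes sign to keep the rate.
  have hmaps : MapsTo (fun x => a + t - x) (Icc a t) (Icc a b) := fun x hx =>
    ⟨by linarith [hx.2], by linarith [hx.1, ht.2]⟩
  have hd : ∀ x ∈ Icc a t, HasDerivWithinAt (fun x => a + t - x) (-1) (Icc a t) x := fun x _ => by
    simpa using (hasDerivWithinAt_id x (Icc a t)).const_sub (a + t)
  have h := norm_le_mul_exp_of_norm_deriv_le (a := a) (b := t) (t := t)
    (Y := fun x => Y (a + t - x)) (Y' := fun x => -Y' (a + t - x))
    (P := fun x => -P (a + t - x)) (k := fun x => k (a + t - x))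
    (fun x hx => by
      have := (hY (a + t - x) (hmaps hx)).scomp x (hd x hx) hmaps
      rw [neg_one_smul] at this
      exact this)
    (fun x hx => by
      have := ((hP (a + t - x) (hmaps hx)).scomp x (hd x hx) hmaps).neg
      rw [neg_one_smul, neg_neg] at this
      exact this)
    (fun x hx => by rw [norm_neg]; exact hk _ (hmaps hx)) ⟨ht.1, le_rfl⟩
  simp only [add_sub_cancel_right, add_sub_cancel_left] at h
  rw [Real.exp_neg, ← div_eq_mul_inv, div_le_iff₀ (Real.exp_pos _)]
  rwa [neg_sub_neg] at h

end Gronwall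

/-! ### Length of curves with right derivatives -/

section Length

/-- The length of a curve with right derivatives `φ` is the increase of any function with right
derivatives `‖φ‖`. -/
lemma eVariationOn_Icc_eq_of_hasDerivWithinAt {E : Type*} [NormedAddCommGroup E] [NormedSpace ℝ E]
    {f φ : ℝ → E} {G : ℝ → ℝ} {a b : ℝ}
    (hab : a ≤ b) (hf : ContinuousOn f (Icc a b)) (hG : ContinuousOn G (Icc a b))
    (hf' : ∀ x ∈ Ico a b, HasDerivWithinAt f (φ x) (Ici x) x)
    (hG' : ∀ x ∈ Ico a b, HasDerivWithinAt G ‖φ x‖ (Ici x) x) :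
    eVariationOn f (Icc a b) = ENNReal.ofReal (G b - G a) := by
  have hle : ∀ x ∈ Icc a b, ∀ y ∈ Icc a b, x ≤ y → ‖f y - f x‖ ≤ G y - G x := by
    intro x hx y hy hxy
    have hsub : Icc x b ⊆ Icc a b := Icc_subset_Icc_left hx.1
    exact image_norm_le_of_norm_deriv_right_le_deriv_boundary' (a := x) (b := b)
      (f := fun y => f y - f x) (f' := φ) ((hf.mono hsub).sub continuousOn_const)
      (fun z hz => (hf' z ⟨hx.1.trans hz.1, hz.2⟩).sub_const _)
      (B := fun y => G y - G x) (B' := fun z => ‖φ z‖) (by simp)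
      ((hG.mono hsub).sub continuousOn_const)
      (fun z hz => (hG' z ⟨hx.1.trans hz.1, hz.2⟩).sub_const _) (fun _ _ => le_rfl) ⟨hxy, hy.2⟩
  have hmono : MonotoneOn G (Icc a b) := fun x hx y hy hxy => by
    linarith [hle x hx y hy hxy, norm_nonneg (f y - f x)]
  have hvle : ∀ x ∈ Icc a b, ∀ y ∈ Icc a b, x ≤ y →
      eVariationOn f (Icc x y) ≤ ENNReal.ofReal (G y - G x) := by
    intro x hx y hy hxy
    have hsub : Icc x y ⊆ Icc a b := Icc_subset_Icc hx.1 hy.2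
    have h1 := (hmono.mono hsub).eVariationOn_eq (left_mem_Icc.2 hxy) (right_mem_Icc.2 hxy)
    rw [inter_self] at h1
    rw [← h1]
    refine iSup_mono fun p => Finset.sum_le_sum fun i _ => ?_
    have hi := p.2.2.2 i
    have hi' := p.2.2.2 (i + 1)
    have hm := p.2.2.1 (Nat.le_succ i)
    rw [edist_dist, edist_dist, dist_eq_norm, dist_eq_norm, Real.norm_eq_abs]
    exact ENNReal.ofReal_le_ofReal
      ((hle _ (hsub hi) _ (hsub hi') hm).trans (le_abs_self _))
  have hfin : ∀ x ∈ Icc a b, ∀ y ∈ Icc a b, x ≤ y → eVariationOn f (Icc x y) ≠ ⊤ :=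
    fun x hx y hy hxy => ((hvle x hx y hy hxy).trans_lt ENNReal.ofReal_lt_top).ne
  set V : ℝ → ℝ := fun t => (eVariationOn f (Icc a t)).toReal with hV
  have hadd : ∀ x ∈ Icc a b, ∀ y ∈ Icc a b, x ≤ y →
      V y - V x = (eVariationOn f (Icc x y)).toReal := by
    intro x hx y hy hxy
    have h := eVariationOn.Icc_add_Icc f (s := univ) hx.1 hxy (mem_univ _)
    simp only [univ_inter] at h
    simp only [hV]
    rw [← h, ENNReal.toReal_add (hfin _ (left_mem_Icc.2 hab) _ hx hx.1) (hfin _ hx _ hy hxy)]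
    ring
  have hup : ∀ x ∈ Icc a b, ∀ y ∈ Icc a b, x ≤ y → V y - V x ≤ G y - G x := by
    intro x hx y hy hxy
    rw [hadd x hx y hy hxy]
    exact ENNReal.toReal_le_of_le_ofReal (by linarith [hmono hx hy hxy]) (hvle x hx y hy hxy)
  have hlow : ∀ x ∈ Icc a b, ∀ y ∈ Icc a b, x ≤ y → ‖f y - f x‖ ≤ V y - V x := by
    intro x hx y hy hxy
    rw [hadd x hx y hy hxy, ← dist_eq_norm, dist_edist]
    exact ENNReal.toReal_mono (hfin x hx y hy hxy)
      (eVariationOn.edist_le f (right_mem_Icc.2 hxy) (left_mem_Icc.2 hxy))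
  have hVc : ContinuousOn V (Icc a b) := by
    rw [Metric.continuousOn_iff]
    intro x hx ε hε
    obtain ⟨d, hd, h⟩ := Metric.continuousOn_iff.1 hG x hx ε hε
    refine ⟨d, hd, fun y hy hyx => lt_of_le_of_lt ?_ (h y hy hyx)⟩
    rw [Real.dist_eq, Real.dist_eq]
    rcases le_total x y with hxy | hxy
    · have h1 := hup x hx y hy hxy
      have h2 := hlow x hx y hy hxy
      rw [abs_of_nonneg ((norm_nonneg _).trans h2)]
      exact h1.trans (le_abs_self _)
    · have h1 := hup y hy x hx hxy
      have h2 := hlow y hy x hx hxy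
      rw [abs_sub_comm, abs_of_nonneg ((norm_nonneg _).trans h2), abs_sub_comm]
      exact h1.trans (le_abs_self _)
  -- The increments of `V` lie between `‖f y - f x‖` and `G y - G x`. To first order both equal `(y
  -- - x) ‖φ x‖`, so `G - V` has right derivative zero.
  have hconst := constant_of_has_deriv_right_zero (f := fun t => G t - V t) (hG.sub hVc) (by
    intro x hx
    have hx' := Ico_subset_Icc_self hx
    rw [hasDerivWithinAt_iff_isLittleO]
    have h1 := (hasDerivWithinAt_iff_isLittleO.1 (hG' x hx)).norm_left
    have h2 := (hasDerivWithinAt_iff_isLittleO.1 (hf' x hx)).norm_left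
    refine Asymptotics.IsBigO.trans_isLittleO (Asymptotics.IsBigO.of_bound 1 ?_) (h1.add h2)
    filter_upwards [Icc_mem_nhdsGE hx.2] with y hy
    have hy' : y ∈ Icc a b := ⟨hx.1.trans hy.1, hy.2⟩
    have e1 := hup x hx' y hy' hy.1
    have e2 := hlow x hx' y hy' hy.1
    have e3 : (y - x) * ‖φ x‖ ≤ ‖f y - f x‖ + ‖f y - f x - (y - x) • φ x‖ := by
      have h3 : (y - x) * ‖φ x‖ = ‖(y - x) • φ x‖ := by
        rw [norm_smul, Real.norm_eq_abs, abs_of_nonneg (sub_nonneg.2 hy.1)]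
      rw [h3, norm_sub_rev (f y - f x)]
      have h5 : (y - x) • φ x = (f y - f x) + ((y - x) • φ x - (f y - f x)) := by abel
      calc ‖(y - x) • φ x‖ = ‖(f y - f x) + ((y - x) • φ x - (f y - f x))‖ := by rw [← h5]
        _ ≤ _ := norm_add_le _ _
    rw [one_mul, smul_zero, sub_zero, Real.norm_eq_abs,
      abs_of_nonneg (by linarith), Real.norm_of_nonneg (by positivity)]
    have h4 := le_abs_self (G y - G x - (y - x) • ‖φ x‖)
    rw [← Real.norm_eq_abs] at h4
    simp only [smul_eq_mul] at h4 ⊢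
    linarith) b (right_mem_Icc.2 hab)
  have hVa : V a = 0 := by
    simp [hV, eVariationOn.subsingleton]
  rw [← ENNReal.ofReal_toReal (a := eVariationOn f (Icc a b))
    (hfin a (left_mem_Icc.2 hab) b (right_mem_Icc.2 hab) hab)]
  congr 1
  change V b = _
  simp only [hVa] at hconst
  linarith

end Length

/-! ### Determinants of block triangular matrices -/

section Det

/-- The determinant of a matrix that is block triangular for the levels `d` is bounded by the
product of the `ℓ¹` norms of the columns of the diagonal blocks. -/
lemma Matrix.norm_det_le_prod_sum_of_level {n : Type*} [Fintype n] [DecidableEq n]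
    (M : Matrix n n ℂ) (d : n → ℕ) (hM : ∀ i j, M i j ≠ 0 → d j ≤ d i) :
    ‖M.det‖ ≤ ∏ j, ∑ i ∈ Finset.univ.filter (fun i => d i = d j), ‖M i j‖ := by
  rw [Matrix.det_apply, Finset.prod_univ_sum]
  refine (norm_sum_le _ _).trans ?_
  have h0 : ∀ σ : Equiv.Perm n, ‖Equiv.Perm.sign σ • ∏ i, M (σ i) i‖ = ∏ i, ‖M (σ i) i‖ := by
    intro σ
    rcases Int.units_eq_one_or (Equiv.Perm.sign σ) with h | h <;> simp [h]
  simp only [h0]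
  -- A nonzero term forces `d i ≤ d (σ i)` for all `i`. Since a permutation preserves the sum of all
  -- levels, these are equalities.
  have hzero : ∀ σ : Equiv.Perm n, (σ : n → n) ∉ Fintype.piFinset
      (fun j => Finset.univ.filter (fun i => d i = d j)) → ∏ i, ‖M (σ i) i‖ = 0 := by
    intro σ hσ
    by_contra hne
    apply hσ
    have hle : ∀ i, d i ≤ d (σ i) := fun i => hM _ _ fun h => hne
      (Finset.prod_eq_zero (Finset.mem_univ i) (by simp [h]))
    have hsum : ∑ i, d i = ∑ i, d (σ i) := (Equiv.sum_comp σ d).symm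
    have := (Finset.sum_eq_sum_iff_of_le (fun i _ => hle i)).1 hsum
    simp only [Fintype.mem_piFinset, Finset.mem_filter, Finset.mem_univ, true_and]
    exact fun i => (this i (Finset.mem_univ i)).symm
  classical
  calc ∑ σ : Equiv.Perm n, ∏ i, ‖M (σ i) i‖
      = ∑ σ ∈ Finset.univ.filter (fun σ : Equiv.Perm n => (σ : n → n) ∈ Fintype.piFinset
          (fun j => Finset.univ.filter (fun i => d i = d j))), ∏ i, ‖M (σ i) i‖ := by
        refine (Finset.sum_subset (Finset.filter_subset _ _) fun σ _ hσ => hzero σ ?_).symm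
        simpa using hσ
    _ = ∑ f ∈ (Finset.univ.filter (fun σ : Equiv.Perm n => (σ : n → n) ∈ Fintype.piFinset
          (fun j => Finset.univ.filter (fun i => d i = d j)))).image (fun σ : Equiv.Perm n => (σ : n → n)),
          ∏ i, ‖M (f i) i‖ := by
        rw [Finset.sum_image]
        exact fun σ _ τ _ h => DFunLike.coe_injective h
    -- The expanded product runs over all level-preserving functions, of which the level-preserving
    -- permutations are some.
    _ ≤ _ := by
        refine Finset.sum_le_sum_of_subset_of_nonneg ?_ fun f _ _ => by positivity
        intro f hf
        obtain ⟨σ, hσ, rfl⟩ := Finset.mem_image.1 hf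
        exact (Finset.mem_filter.1 hσ).2

end Det

/-! ### Maximum norm and Euclidean norm on `ℝ × ℂ` -/

section ProdNorm

/-- The Euclidean norm on `ℝ × ℂ` dominates the maximum norm. -/
lemma norm_le_norm_toLp_two (z : ℝ × ℂ) : ‖z‖ ≤ ‖WithLp.toLp 2 z‖ := by
  rw [WithLp.prod_norm_eq_of_L2]
  refine Real.le_sqrt_of_sq_le ?_
  rcases max_choice ‖z.1‖ ‖z.2‖ with h | h
  · rw [Prod.norm_def, h]
    exact le_add_of_nonneg_right (sq_nonneg _)
  · rw [Prod.norm_def, h]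
    exact le_add_of_nonneg_left (sq_nonneg _)

/-- The source of every `√2` in the rates: distances to singular sets are Euclidean, while flow
lines are measured in the maximum norm. -/
lemma norm_toLp_two_le (z : ℝ × ℂ) : ‖WithLp.toLp 2 z‖ ≤ √2 * ‖z‖ := by
  rw [WithLp.prod_norm_eq_of_L2]
  refine Real.sqrt_le_iff.2 ⟨by positivity, ?_⟩
  rw [mul_pow, Real.sq_sqrt zero_le_two]
  have h1 : ‖z.1‖ ^ 2 ≤ ‖z‖ ^ 2 := by gcongr; exact norm_fst_le z
  have h2 : ‖z.2‖ ^ 2 ≤ ‖z‖ ^ 2 := by gcongr; exact norm_snd_le z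
  change ‖z.1‖ ^ 2 + ‖z.2‖ ^ 2 ≤ _
  linarith

end ProdNorm

/-! ### Singular sets with the origin adjoined, and subadditivity of the distance -/

namespace DFS

/-- The set `{0} ∪ 𝒮_Ω`. -/
def pointedSet (Ω : DFS) : Set (WithLp 2 (ℝ × ℂ)) := insert 0 Ω.singSet

lemma zero_mem_pointedSet (Ω : DFS) : 0 ∈ Ω.pointedSet := Set.mem_insert _ _

/-- `Metric.infDist` to the empty set has the default value `0`; the origin keeps `eta` a true
distance even if there are no singular points. -/
lemma pointedSet_nonempty (Ω : DFS) : Ω.pointedSet.Nonempty := ⟨0, Ω.zero_mem_pointedSet⟩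

/-- Adjoining the origin turns the three-part union that defines `conv` into a Minkowski sum. This
lemma and the next are the two inclusions. -/
lemma add_mem_pointedSet_conv {Ω Ω' : DFS} {p q : WithLp 2 (ℝ × ℂ)} (hp : p ∈ Ω.pointedSet)
    (hq : q ∈ Ω'.pointedSet) : p + q ∈ (Ω.conv Ω').pointedSet := by
  rcases hp with rfl | ⟨l, w, hw, rfl⟩ <;> rcases hq with rfl | ⟨l', w', hw', rfl⟩
  · rw [add_zero]
    exact zero_mem_pointedSet _
  · rw [zero_add]
    exact Or.inr ⟨l', w', Or.inr hw', rfl⟩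
  · rw [add_zero]
    exact Or.inr ⟨l, w, Or.inl (Or.inr hw), rfl⟩
  · refine Or.inr ⟨l + l', w + w', Or.inl (Or.inl ⟨l, l', rfl, w, hw, w', hw', rfl⟩), ?_⟩
    rw [← WithLp.toLp_add, Prod.mk_add_mk, NNReal.coe_add]

lemma exists_add_of_mem_pointedSet_conv {Ω Ω' : DFS} {p : WithLp 2 (ℝ × ℂ)}
    (hp : p ∈ (Ω.conv Ω').pointedSet) : ∃ q ∈ Ω.pointedSet, ∃ r ∈ Ω'.pointedSet, q + r = p := by
  rcases hp with rfl | ⟨l, w, (⟨l₁, l₂, rfl, w₁, h₁, w₂, h₂, rfl⟩ | hw) | hw, rfl⟩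
  · exact ⟨0, zero_mem_pointedSet _, 0, zero_mem_pointedSet _, add_zero 0⟩
  · refine ⟨_, Or.inr ⟨l₁, w₁, h₁, rfl⟩, _, Or.inr ⟨l₂, w₂, h₂, rfl⟩, ?_⟩
    rw [← WithLp.toLp_add, Prod.mk_add_mk, NNReal.coe_add]
  · exact ⟨_, Or.inr ⟨l, w, hw, rfl⟩, 0, zero_mem_pointedSet _, add_zero _⟩
  · exact ⟨0, zero_mem_pointedSet _, _, Or.inr ⟨l, w, hw, rfl⟩, zero_add _⟩

lemma add_mem_pointedSet_convPow (Ω : DFS) {m n : ℕ} {p q : WithLp 2 (ℝ × ℂ)}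
    (hp : p ∈ (Ω.convPow m).pointedSet) (hq : q ∈ (Ω.convPow n).pointedSet) :
    p + q ∈ (Ω.convPow (m + n)).pointedSet := by
  induction n generalizing q with
  | zero =>
    rcases hq with rfl | ⟨l, w, hw, rfl⟩
    · simpa using hp
    · exact hw.elim
  | succ n ih =>
    obtain ⟨q₁, h₁, q₂, h₂, rfl⟩ := exists_add_of_mem_pointedSet_conv hq
    rw [← add_assoc p]
    exact add_mem_pointedSet_conv (ih h₁) h₂

lemma sum_mem_pointedSet_convPow (Ω : DFS) {ι : Type*} (s : Finset ι) (w : ι → ℕ)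
    (p : ι → WithLp 2 (ℝ × ℂ)) (hp : ∀ i ∈ s, p i ∈ (Ω.convPow (w i)).pointedSet) :
    ∑ i ∈ s, p i ∈ (Ω.convPow (∑ i ∈ s, w i)).pointedSet := by
  classical
  induction s using Finset.induction_on with
  | empty => exact zero_mem_pointedSet _
  | insert i s hi ih =>
    rw [Finset.sum_insert hi, Finset.sum_insert hi]
    exact Ω.add_mem_pointedSet_convPow (hp i (Finset.mem_insert_self i s))
      (ih fun j hj => hp j (Finset.mem_insert_of_mem hj))

lemma convPow_set_eq_empty (Ω : DFS) {r : ℝ≥0} (hr : Ω.set r = ∅) (n : ℕ) :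
    (Ω.convPow n).set r = ∅ := by
  induction n with
  | zero => rfl
  | succ n ih =>
    have h : ∀ L ≤ r, (Ω.convPow n).set L = ∅ := fun L hL =>
      Set.subset_empty_iff.1 (ih ▸ (Ω.convPow n).mono' hL)
    change _ ∪ _ ∪ _ = _
    rw [hr, ih, Set.union_empty, Set.union_empty, Set.eq_empty_iff_forall_notMem]
    rintro z ⟨L₁, L₂, hL, w₁, hw, -⟩
    rw [h L₁ (hL ▸ le_self_add)] at hw
    exact hw

/-- The points of `𝒮_{Ω^{*n}}` lie above level `r` if `r < ρ(Ω)`. -/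
lemma lt_fst_of_mem_singSet_convPow (Ω : DFS) {r : ℝ} (hr : ENNReal.ofReal r < Ω.rho) {n : ℕ}
    {p : WithLp 2 (ℝ × ℂ)} (hp : p ∈ (Ω.convPow n).singSet) : r < p.fst := by
  obtain ⟨r', h⟩ := lt_iSup_iff.1 hr
  obtain ⟨he, h⟩ := lt_iSup_iff.1 h
  obtain ⟨l, w, hw, rfl⟩ := hp
  have hl : r' < l := by
    by_contra hle
    have h1 := (Ω.convPow n).mono' (not_lt.1 hle) hw
    rw [Ω.convPow_set_eq_empty he n] at h1
    exact h1
  have h2 : r < r' := by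
    by_contra hle
    exact absurd h (not_lt.2 (by
      rw [← ENNReal.ofReal_coe_nnreal]
      exact ENNReal.ofReal_le_ofReal (not_lt.1 hle)))
  exact h2.trans (NNReal.coe_lt_coe.2 hl)

/-- The Euclidean distance to `{0} ∪ 𝒮_Ω`. -/
noncomputable def eta (Ω : DFS) (z : ℝ × ℂ) : ℝ := Metric.infDist (WithLp.toLp 2 z) Ω.pointedSet

lemma eta_nonneg (Ω : DFS) (z : ℝ × ℂ) : 0 ≤ Ω.eta z := Metric.infDist_nonneg

lemma eta_le_of_mem (Ω : DFS) (z : ℝ × ℂ) {p : WithLp 2 (ℝ × ℂ)} (hp : p ∈ Ω.pointedSet) :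
    Ω.eta z ≤ √2 * ‖z - p.ofLp‖ := by
  refine (Metric.infDist_le_dist_of_mem hp).trans ?_
  rw [dist_eq_norm]
  exact norm_toLp_two_le (z - p.ofLp)

lemma abs_eta_sub_le (Ω : DFS) (z z' : ℝ × ℂ) : |Ω.eta z - Ω.eta z'| ≤ √2 * ‖z - z'‖ := by
  have h : ∀ x y, Ω.eta x - Ω.eta y ≤ √2 * ‖x - y‖ := by
    intro x y
    have h1 := Metric.infDist_le_infDist_add_dist (s := Ω.pointedSet) (x := WithLp.toLp 2 x)
      (y := WithLp.toLp 2 y)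
    have h2 := norm_toLp_two_le (x - y)
    rw [WithLp.toLp_sub, ← dist_eq_norm] at h2
    unfold eta
    linarith
  rw [abs_sub_le_iff]
  exact ⟨h z z', by rw [norm_sub_rev]; exact h z' z⟩

/-- Almost nearest points to the `y i` add up to a point of the pointed set of the sum, so the
distances add. The last term measures how far `z` is from the sum of the `y i`. -/
lemma eta_convPow_sum_le (Ω : DFS) {ι : Type*} (s : Finset ι) (w : ι → ℕ) (y : ι → ℝ × ℂ)
    (z : ℝ × ℂ) : (Ω.convPow (∑ i ∈ s, w i)).eta z ≤
      ∑ i ∈ s, (Ω.convPow (w i)).eta (y i) + √2 * ‖z - ∑ i ∈ s, y i‖ := by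
  refine le_of_forall_pos_le_add fun ε hε => ?_
  -- The `+ 1` keeps the divisor positive when `s` is empty.
  have hε' : 0 < ε / (s.card + 1) := by positivity
  have hex : ∀ i, ∃ p ∈ (Ω.convPow (w i)).pointedSet,
      dist (WithLp.toLp 2 (y i)) p < (Ω.convPow (w i)).eta (y i) + ε / (s.card + 1) := fun i =>
    (Metric.infDist_lt_iff (pointedSet_nonempty _)).1 (lt_add_of_pos_right _ hε')
  choose p hp hd using hex
  have hmem := Ω.sum_mem_pointedSet_convPow s w p fun i _ => hp i
  have h1 : (Ω.convPow (∑ i ∈ s, w i)).eta z ≤ dist (WithLp.toLp 2 z) (∑ i ∈ s, p i) :=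
    Metric.infDist_le_dist_of_mem hmem
  have h2 : dist (WithLp.toLp 2 z) (∑ i ∈ s, WithLp.toLp 2 (y i)) ≤ √2 * ‖z - ∑ i ∈ s, y i‖ := by
    have := norm_toLp_two_le (z - ∑ i ∈ s, y i)
    rwa [WithLp.toLp_sub, WithLp.toLp_sum, ← dist_eq_norm] at this
  have h3 : dist (∑ i ∈ s, WithLp.toLp 2 (y i)) (∑ i ∈ s, p i) ≤
      ∑ i ∈ s, (Ω.convPow (w i)).eta (y i) + ε := by
    refine (dist_sum_sum_le_of_le s fun i _ => (hd i).le).trans ?_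
    rw [Finset.sum_add_distrib, Finset.sum_const, nsmul_eq_mul]
    gcongr
    rw [mul_div_assoc', div_le_iff₀ (by positivity)]
    nlinarith
  linarith [dist_triangle (WithLp.toLp 2 z) (∑ i ∈ s, WithLp.toLp 2 (y i)) (∑ i ∈ s, p i)]

end DFS

/-! ### Combinatorics of the tree: parents, depth, dependence sets, weights -/

namespace IterationDiagram

open Relation

variable {V : Type*} [Fintype V] (T : IterationDiagram V)

lemma not_edge_root (u : V) : ¬ T.edge T.root u := by
  obtain ⟨x, hx⟩ := T.exists_sink
  rcases ReflTransGen.cases_head (T.root_spec x) with h | ⟨y, hy, -⟩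
  · exact h ▸ hx u
  · exact absurd hy (hx y)

lemma exists_edge {v : V} (hv : v ≠ T.root) : ∃ u, T.edge v u := by
  rcases ReflTransGen.cases_head (T.root_spec v) with h | ⟨y, hy, -⟩
  · exact absurd h hv
  · exact ⟨y, hy⟩

open scoped Classical in
/-- The successor of a vertex; the root is its own successor. -/
noncomputable def parent (v : V) : V := if h : ∃ u, T.edge v u then h.choose else v

lemma edge_parent {v : V} (hv : v ≠ T.root) : T.edge v (T.parent v) := by
  rw [parent, dif_pos (T.exists_edge hv)]
  exact (T.exists_edge hv).choose_spec

lemma parent_root : T.parent T.root = T.root := by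
  rw [parent, dif_neg (by rintro ⟨u, hu⟩; exact T.not_edge_root u hu)]

lemma edge_iff {v u : V} : T.edge v u ↔ v ≠ T.root ∧ T.parent v = u := by
  constructor
  · intro h
    have hv : v ≠ T.root := by
      rintro rfl
      exact T.not_edge_root u h
    exact ⟨hv, T.out_unique v _ _ (T.edge_parent hv) h⟩
  · rintro ⟨hv, rfl⟩
    exact T.edge_parent hv

lemma mem_children {v u : V} : u ∈ T.children v ↔ u ≠ T.root ∧ T.parent u = v := by
  rw [← T.edge_iff]
  simp [children]

lemma exists_iterate_parent (v : V) : ∃ n, T.parent^[n] v = T.root := by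
  refine ReflTransGen.head_induction_on (T.root_spec v) ⟨0, rfl⟩ ?_
  rintro x y hxy - ⟨n, hn⟩
  refine ⟨n + 1, ?_⟩
  rw [Function.iterate_succ_apply, (T.edge_iff.1 hxy).2, hn]

open scoped Classical in
/-- The distance of a vertex to the root. -/
noncomputable def depth (v : V) : ℕ := Nat.find (T.exists_iterate_parent v)

lemma depth_root : T.depth T.root = 0 := by
  classical
  exact (Nat.find_eq_zero _).2 rfl

lemma depth_of_ne {v : V} (hv : v ≠ T.root) : T.depth v = T.depth (T.parent v) + 1 := by
  classical
  exact Nat.find_comp_succ (T.exists_iterate_parent v) (T.exists_iterate_parent (T.parent v)) hv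

lemma depth_lt_of_edge {v u : V} (h : T.edge v u) : T.depth u < T.depth v := by
  obtain ⟨hv, rfl⟩ := T.edge_iff.1 h
  rw [T.depth_of_ne hv]
  exact Nat.lt_succ_self _

lemma depth_lt_of_transGen {v u : V} (h : TransGen T.edge v u) : T.depth u < T.depth v := by
  induction h with
  | single h => exact T.depth_lt_of_edge h
  | tail _ h ih => exact (T.depth_lt_of_edge h).trans ih

/-- Induction along the tree, from the root towards the leaves. -/
lemma induction_parent {P : V → Prop} (root : P T.root)
    (step : ∀ v, v ≠ T.root → P (T.parent v) → P v) (v : V) : P v := by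
  induction hn : T.depth v generalizing v with
  | zero =>
    by_cases hv : v = T.root
    · exact hv ▸ root
    · rw [T.depth_of_ne hv] at hn
      exact absurd hn (Nat.succ_ne_zero _)
  | succ n ih =>
    have hv : v ≠ T.root := by
      rintro rfl
      rw [T.depth_root] at hn
      exact absurd hn.symm (Nat.succ_ne_zero _)
    rw [T.depth_of_ne hv] at hn
    exact step v hv (ih _ (Nat.succ.inj hn))

lemma root_mem_depSet (v : V) : T.root ∈ T.depSet v := Or.inl rfl

lemma mem_depSet_of_parent_eq {v u : V} (hv : v ≠ T.root) (hu : u ≠ T.root)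
    (h : T.parent u = T.parent v) : u ∈ T.depSet v :=
  Or.inr ⟨T.parent v, .single (T.edge_parent hv), T.edge_iff.2 ⟨hu, h⟩⟩

lemma self_mem_depSet (v : V) : v ∈ T.depSet v := by
  by_cases hv : v = T.root
  · exact Or.inl hv
  · exact T.mem_depSet_of_parent_eq hv hv rfl

/-- This makes the coordinates in `W_v` a closed subsystem of the differential equation. -/
lemma depSet_subset_of_mem {v u : V} (hu : u ∈ T.depSet v) : T.depSet u ⊆ T.depSet v := by
  rintro x (hx | ⟨y, hy, hxy⟩)
  · exact Or.inl hx
  · rcases hu with hu | ⟨z, hz, huz⟩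
    · rw [Set.mem_singleton_iff] at hu
      subst hu
      obtain ⟨w, hw, -⟩ := TransGen.head'_iff.1 hy
      exact absurd hw (T.not_edge_root w)
    · refine Or.inr ⟨y, ?_, hxy⟩
      obtain ⟨w, hw, hwy⟩ := TransGen.head'_iff.1 hy
      rw [T.out_unique u w z hw huz] at hwy
      exact hz.trans_left hwy

lemma parent_mem_depSet (v : V) : T.parent v ∈ T.depSet v := by
  by_cases hv : v = T.root
  · rw [hv, T.parent_root]
    exact T.root_mem_depSet _
  by_cases hp : T.parent v = T.root
  · exact Or.inl hp
  · exact Or.inr ⟨_, (TransGen.single (T.edge_parent hv)).tail (T.edge_parent hp), T.edge_parent hp⟩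

lemma depth_le_of_mem_depSet {v u : V} (h : u ∈ T.depSet v) : T.depth u ≤ T.depth v := by
  rcases h with rfl | ⟨w, hw, hu⟩
  · rw [T.depth_root]
    exact Nat.zero_le _
  · obtain ⟨hu', rfl⟩ := T.edge_iff.1 hu
    rw [T.depth_of_ne hu']
    exact T.depth_lt_of_transGen hw

/-- Identifies the diagonal blocks of the Jacobian: within one depth only siblings influence each
other. -/
lemma parent_eq_of_mem_depSet {v u : V} (h : u ∈ T.depSet v) (hu : u ≠ T.root)
    (hd : T.depth v = T.depth u) : T.parent v = T.parent u := by
  rcases h with rfl | ⟨w, hw, hu'⟩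
  · exact absurd rfl hu
  · obtain ⟨-, rfl⟩ := T.edge_iff.1 hu'
    obtain ⟨x, hx, hxw⟩ := TransGen.head'_iff.1 hw
    obtain ⟨hv, rfl⟩ := T.edge_iff.1 hx
    rw [T.depth_of_ne hv, T.depth_of_ne hu] at hd
    rcases reflTransGen_iff_eq_or_transGen.1 hxw with h | h
    · exact h.symm
    · have := T.depth_lt_of_transGen h
      omega

lemma notMem_depSet_parent {v u : V} (hu : u ≠ T.root)
    (h : T.parent u = T.parent v) : u ∉ T.depSet (T.parent v) := fun hmem => by
  have h1 := T.depth_le_of_mem_depSet hmem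
  rw [T.depth_of_ne hu, h] at h1
  omega

/-- Vertices have at most one outgoing edge, so two children reachable from a common leaf would be
comparable, which their equal depth excludes unless they coincide. Hence `Ω_v` is the sum of the
`Ω_u` over the children. -/
lemma weight_eq_sum_children {v : V} (hv : ¬ T.IsLeaf v) :
    T.weight v = ∑ u ∈ T.children v, T.weight u := by
  classical
  have hcard : ∀ v, T.weight v =
      (Finset.univ.filter fun l => T.IsLeaf l ∧ ReflTransGen T.edge l v).card := fun v => by
    rw [weight, ← Set.ncard_coe_finset]
    simp
  simp only [hcard]
  rw [← Finset.card_biUnion]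
  · congr 1
    ext l
    simp only [Finset.mem_filter, Finset.mem_univ, true_and, Finset.mem_biUnion]
    constructor
    · rintro ⟨hl, h⟩
      rcases ReflTransGen.cases_tail h with h | ⟨c, hc, hcv⟩
      · exact absurd hl (h ▸ hv)
      · exact ⟨c, by simpa [children] using hcv, hl, hc⟩
    · rintro ⟨c, hc, hl, h⟩
      exact ⟨hl, h.tail (by simpa [children] using hc)⟩
  · intro c hc c' hc' hne
    rw [Function.onFun, Finset.disjoint_left]
    intro l hl hl'
    simp only [Finset.mem_filter, Finset.mem_univ, true_and] at hl hl'
    obtain ⟨h1, h2⟩ := T.mem_children.1 hc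
    obtain ⟨h1', h2'⟩ := T.mem_children.1 hc'
    have hd : T.depth c = T.depth c' := by
      rw [T.depth_of_ne h1, T.depth_of_ne h1', h2, h2']
    rcases ReflTransGen.total_of_right_unique (fun a b c => T.out_unique a b c) hl.2 hl'.2 with
      h | h <;> rcases reflTransGen_iff_eq_or_transGen.1 h with h | h
    · exact hne h.symm
    · exact absurd (T.depth_lt_of_transGen h) (by omega)
    · exact hne h
    · exact absurd (T.depth_lt_of_transGen h) (by omega)

lemma le_one_of_mem_simplex {s : V → ℝ} (hs : s ∈ T.simplex) (v : V) : s v ≤ 1 := by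
  refine T.induction_parent (P := fun v => s v ≤ 1) hs.2.2.le (fun v hv ih => ?_) v
  refine le_trans ?_ ((hs.2.1 (T.parent v)).trans ih)
  exact Finset.single_le_sum (f := s) (fun u _ => hs.1 u) (T.mem_children.2 ⟨hv, rfl⟩)

end IterationDiagram

/-- The inductive step for the Lipschitz continuity of the speeds, with `B` the speed of the parent,
`A` a height and `D` the denominator. The quotient is harmless near `D = 0` because `A` and `B` are
both controlled by `D`. -/
lemma abs_mul_div_sub_le {A A' B B' D D' C : ℝ} (hC : 0 ≤ C) (hA : 0 ≤ A) (hA' : 0 ≤ A')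
    (hAD : A ≤ D) (hAD' : A' ≤ D') (hB : 0 ≤ B) (hB' : 0 ≤ B') (hBD : B ≤ C * D)
    (hBD' : B' ≤ C * D') :
    |B * (A / D) - B' * (A' / D')| ≤ C * |A - A'| + |B - B'| + C * |D - D'| := by
  -- With the larger denominator `D`, the mixed quotient `A' / D` in the decomposition is at most
  -- `1`.
  wlog h : D' ≤ D generalizing A A' B B' D D'
  · have := this hA' hA hAD' hAD hB' hB hBD' hBD (le_of_not_ge h)
    rwa [abs_sub_comm, abs_sub_comm A, abs_sub_comm B, abs_sub_comm D]
  have hD : 0 ≤ D := hA.trans hAD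
  have hD' : 0 ≤ D' := hA'.trans hAD'
  rcases hD.eq_or_lt with h0 | h0
  · obtain rfl : D' = 0 := le_antisymm (h0 ▸ h) hD'
    simp only [← h0, div_zero, mul_zero, sub_self, abs_zero]
    positivity
  have e1 : B / D ≤ C := (div_le_iff₀ h0).2 hBD
  have e2 : A' / D ≤ 1 := (div_le_one h0).2 (hAD'.trans h)
  rcases hD'.eq_or_lt with h1 | h1
  · obtain rfl : A' = 0 := le_antisymm (h1 ▸ hAD') hA'
    rw [zero_div, mul_zero, sub_zero, sub_zero, abs_of_nonneg (by positivity), abs_of_nonneg hA]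
    have : B * (A / D) = B / D * A := by ring
    rw [this]
    have := mul_le_mul_of_nonneg_right e1 hA
    have := abs_nonneg (B - B')
    have := mul_nonneg hC (abs_nonneg (D - D'))
    linarith
  have e3 : B' / D' ≤ C := (div_le_iff₀ h1).2 hBD'
  have key : B * (A / D) - B' * (A' / D') =
      B / D * (A - A') + A' / D * (B - B') + A' / D * (B' / D') * (D' - D) := by
    field_simp
    ring
  rw [key]
  refine (abs_add_three _ _ _).trans ?_
  rw [abs_mul, abs_mul, abs_mul, abs_of_nonneg (by positivity : 0 ≤ B / D),
    abs_of_nonneg (by positivity : 0 ≤ A' / D),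
    abs_of_nonneg (by positivity : 0 ≤ A' / D * (B' / D')), abs_sub_comm D' D]
  have e4 : A' / D * (B' / D') ≤ C := by
    calc A' / D * (B' / D') ≤ 1 * C := by gcongr
      _ = C := one_mul C
  gcongr
  exact mul_le_of_le_one_left (abs_nonneg _) e2

/-! ### The vector field and its Lipschitz estimates -/

namespace IterationDiagram

variable {V : Type*} [Fintype V] (T : IterationDiagram V) (Ω : DFS) (δ : ℝ)

open scoped Classical in
/-- The distance of `ζ_v` to `{0} ∪ 𝒮_{Ω_v}`, replaced by its lower bound `δ` at the root. -/
noncomputable def height (v : V) (ζ : V → ℝ × ℂ) : ℝ :=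
  if v = T.root then δ else (T.dfsAt Ω v).eta (ζ v)

/-- The denominator of the speeds of the children of `v`. -/
noncomputable def denom (v : V) (ζ : V → ℝ × ℂ) : ℝ :=
  max (∑ u ∈ T.children v, T.height Ω δ u ζ) (T.height Ω δ v ζ)

/-- The speed of `ζ_v`, relative to that of the root. -/
noncomputable def speed (v : V) (ζ : V → ℝ × ℂ) : ℝ :=
  ∏ i ∈ Finset.range (T.depth v),
    T.height Ω δ (T.parent^[i] v) ζ / T.denom Ω δ (T.parent^[i + 1] v) ζ

variable {T Ω δ}

lemma height_root (ζ : V → ℝ × ℂ) : T.height Ω δ T.root ζ = δ := if_pos rfl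

lemma height_of_ne {v : V} (hv : v ≠ T.root) (ζ : V → ℝ × ℂ) :
    T.height Ω δ v ζ = (T.dfsAt Ω v).eta (ζ v) := if_neg hv

lemma height_nonneg (hδ : 0 ≤ δ) (v : V) (ζ : V → ℝ × ℂ) : 0 ≤ T.height Ω δ v ζ := by
  unfold height
  split_ifs
  exacts [hδ, DFS.eta_nonneg _ _]

lemma abs_height_sub_le (v : V) (ζ ζ' : V → ℝ × ℂ) :
    |T.height Ω δ v ζ - T.height Ω δ v ζ'| ≤ √2 * ‖ζ v - ζ' v‖ := by
  unfold height
  split_ifs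
  · rw [sub_self, abs_zero]
    positivity
  · exact DFS.abs_eta_sub_le _ _ _

lemma height_congr {v : V} {ζ ζ' : V → ℝ × ℂ} (h : ζ v = ζ' v) :
    T.height Ω δ v ζ = T.height Ω δ v ζ' := by
  unfold height
  rw [h]

lemma height_le_denom (v : V) (ζ : V → ℝ × ℂ) : T.height Ω δ v ζ ≤ T.denom Ω δ v ζ :=
  le_max_right _ _

lemma denom_nonneg (hδ : 0 ≤ δ) (v : V) (ζ : V → ℝ × ℂ) : 0 ≤ T.denom Ω δ v ζ :=
  (height_nonneg hδ v ζ).trans (height_le_denom v ζ)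

lemma height_le_denom_parent (hδ : 0 ≤ δ) {v : V} (hv : v ≠ T.root) (ζ : V → ℝ × ℂ) :
    T.height Ω δ v ζ ≤ T.denom Ω δ (T.parent v) ζ :=
  le_trans (Finset.single_le_sum (f := fun u => T.height Ω δ u ζ)
    (fun u _ => height_nonneg hδ u ζ) (T.mem_children.2 ⟨hv, rfl⟩)) (le_max_left _ _)

lemma speed_root (ζ : V → ℝ × ℂ) : T.speed Ω δ T.root ζ = 1 := by
  rw [speed, T.depth_root, Finset.prod_range_zero]

lemma speed_of_ne {v : V} (hv : v ≠ T.root) (ζ : V → ℝ × ℂ) :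
    T.speed Ω δ v ζ =
      T.speed Ω δ (T.parent v) ζ * (T.height Ω δ v ζ / T.denom Ω δ (T.parent v) ζ) := by
  rw [speed, T.depth_of_ne hv, Finset.prod_range_succ']
  rfl

lemma speed_of_mem_children {v u : V} (hu : u ∈ T.children v) (ζ : V → ℝ × ℂ) :
    T.speed Ω δ u ζ = T.speed Ω δ v ζ * (T.height Ω δ u ζ / T.denom Ω δ v ζ) := by
  obtain ⟨hu', rfl⟩ := T.mem_children.1 hu
  exact speed_of_ne hu' ζ

lemma speed_nonneg (hδ : 0 ≤ δ) (v : V) (ζ : V → ℝ × ℂ) : 0 ≤ T.speed Ω δ v ζ :=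
  Finset.prod_nonneg fun _ _ => div_nonneg (height_nonneg hδ _ _) (denom_nonneg hδ _ _)

lemma sum_speed_children (v : V) (ζ : V → ℝ × ℂ) :
    ∑ u ∈ T.children v, T.speed Ω δ u ζ =
      T.speed Ω δ v ζ * ((∑ u ∈ T.children v, T.height Ω δ u ζ) / T.denom Ω δ v ζ) := by
  rw [Finset.sum_div, Finset.mul_sum]
  exact Finset.sum_congr rfl fun u hu => speed_of_mem_children hu ζ

lemma sum_speed_children_le (hδ : 0 ≤ δ) (v : V) (ζ : V → ℝ × ℂ) :
    ∑ u ∈ T.children v, T.speed Ω δ u ζ ≤ T.speed Ω δ v ζ := by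
  rw [sum_speed_children]
  exact mul_le_of_le_one_right (speed_nonneg hδ v ζ)
    (div_le_one_of_le₀ (le_max_left _ _) (denom_nonneg hδ v ζ))

lemma speed_le_one (hδ : 0 ≤ δ) (v : V) (ζ : V → ℝ × ℂ) : T.speed Ω δ v ζ ≤ 1 := by
  refine T.induction_parent (P := fun v => T.speed Ω δ v ζ ≤ 1) (speed_root ζ).le
    (fun v hv ih => ?_) v
  rw [speed_of_ne hv]
  exact mul_le_one₀ ih (div_nonneg (height_nonneg hδ _ _) (denom_nonneg hδ _ _))
    (div_le_one_of_le₀ (height_le_denom_parent hδ hv ζ) (denom_nonneg hδ _ ζ))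

/-- Induction from the root, where the height is `δ`: the denominator dominates the height of the
parent, so the bound for the parent cancels against it and leaves the height of the child. The speed
thus vanishes linearly at `0` and at the singular points of a non-root vertex. -/
lemma speed_le_height (hδ : 0 < δ) (v : V) (ζ : V → ℝ × ℂ) :
    T.speed Ω δ v ζ ≤ δ⁻¹ * T.height Ω δ v ζ := by
  refine T.induction_parent (P := fun v => T.speed Ω δ v ζ ≤ δ⁻¹ * T.height Ω δ v ζ) ?_
    (fun v hv ih => ?_) v
  · rw [speed_root, height_root, inv_mul_cancel₀ hδ.ne']
  · have hv0 := height_nonneg (T := T) (Ω := Ω) hδ.le v ζ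
    have hD0 := denom_nonneg (T := T) (Ω := Ω) hδ.le (T.parent v) ζ
    rw [speed_of_ne hv]
    calc _ ≤ δ⁻¹ * T.denom Ω δ (T.parent v) ζ *
          (T.height Ω δ v ζ / T.denom Ω δ (T.parent v) ζ) := by
          gcongr
          exact ih.trans (by gcongr; exact height_le_denom _ _)
      _ = δ⁻¹ * (T.denom Ω δ (T.parent v) ζ *
          (T.height Ω δ v ζ / T.denom Ω δ (T.parent v) ζ)) := by ring
      _ ≤ _ := by
          gcongr
          rw [mul_div_left_comm]
          exact mul_le_of_le_one_right hv0 (div_self_le_one _)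

lemma speed_le_denom (hδ : 0 < δ) (v : V) (ζ : V → ℝ × ℂ) :
    T.speed Ω δ v ζ ≤ δ⁻¹ * T.denom Ω δ v ζ :=
  (speed_le_height hδ v ζ).trans (by gcongr; exact height_le_denom _ _)

/-- The denominators along the path to the root involve the siblings of the vertices on it, and
these are what `W_v` collects. -/
lemma speed_congr (v : V) {ζ ζ' : V → ℝ × ℂ} (h : ∀ u ∈ T.depSet v, ζ u = ζ' u) :
    T.speed Ω δ v ζ = T.speed Ω δ v ζ' := by
  induction v using T.induction_parent with
  | root => rw [speed_root, speed_root]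
  | step v hv ih =>
    have hp := h _ (T.parent_mem_depSet v)
    have hd : T.denom Ω δ (T.parent v) ζ = T.denom Ω δ (T.parent v) ζ' := by
      unfold denom
      rw [height_congr hp]
      congr 1
      refine Finset.sum_congr rfl fun u hu => height_congr (h u ?_)
      obtain ⟨hu, h⟩ := T.mem_children.1 hu
      exact T.mem_depSet_of_parent_eq hv hu h
    rw [speed_of_ne hv, speed_of_ne hv, hd, height_congr (h v (T.self_mem_depSet v)),
      ih fun u hu => h u (T.depSet_subset_of_mem (T.parent_mem_depSet v) hu)]

lemma abs_sum_height_sub_le (v : V) (ζ ζ' : V → ℝ × ℂ) :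
    |∑ u ∈ T.children v, T.height Ω δ u ζ - ∑ u ∈ T.children v, T.height Ω δ u ζ'| ≤
      ∑ u ∈ T.children v, |T.height Ω δ u ζ - T.height Ω δ u ζ'| := by
  rw [← Finset.sum_sub_distrib]
  exact Finset.abs_sum_le_sum_abs _ _

lemma abs_denom_sub_le (v : V) (ζ ζ' : V → ℝ × ℂ) :
    |T.denom Ω δ v ζ - T.denom Ω δ v ζ'| ≤ (Fintype.card V + 1) * √2 * ‖ζ - ζ'‖ := by
  have hu : ∀ u, |T.height Ω δ u ζ - T.height Ω δ u ζ'| ≤ √2 * ‖ζ - ζ'‖ := fun u =>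
    (abs_height_sub_le u ζ ζ').trans (by gcongr; exact norm_le_pi_norm (ζ - ζ') u)
  refine (abs_max_sub_max_le_max _ _ _ _).trans (max_le ?_ ?_)
  · refine (abs_sum_height_sub_le v ζ ζ').trans ((Finset.sum_le_sum fun u _ => hu u).trans ?_)
    rw [Finset.sum_const, nsmul_eq_mul, mul_assoc]
    have : ((T.children v).card : ℝ) ≤ Fintype.card V + 1 := by
      have := Finset.card_le_univ (T.children v)
      have : ((T.children v).card : ℝ) ≤ Fintype.card V := by exact_mod_cast this
      linarith
    gcongr
  · refine (hu v).trans ?_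
    rw [mul_assoc]
    exact le_mul_of_one_le_left (by positivity) (by simp)

/-- This constant serves existence, uniqueness and regularity of the flow only, so its size is
irrelevant. The Jacobian bound needs the sharper `ℓ¹` estimate below. -/
lemma exists_abs_speed_sub_le (hδ : 0 < δ) (v : V) :
    ∃ K : ℝ, 0 ≤ K ∧ ∀ ζ ζ', |T.speed Ω δ v ζ - T.speed Ω δ v ζ'| ≤ K * ‖ζ - ζ'‖ := by
  induction v using T.induction_parent with
  | root => exact ⟨0, le_rfl, fun ζ ζ' => by simp [speed_root]⟩
  | step v hv ih =>
    obtain ⟨K, hK, h⟩ := ih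
    refine ⟨δ⁻¹ * √2 + K + δ⁻¹ * ((Fintype.card V + 1) * √2), by positivity, fun ζ ζ' => ?_⟩
    rw [speed_of_ne hv, speed_of_ne hv]
    refine (abs_mul_div_sub_le (inv_nonneg.2 hδ.le) (height_nonneg hδ.le _ _)
      (height_nonneg hδ.le _ _) (height_le_denom_parent hδ.le hv _)
      (height_le_denom_parent hδ.le hv _) (speed_nonneg hδ.le _ _) (speed_nonneg hδ.le _ _)
      (speed_le_denom hδ _ _) (speed_le_denom hδ _ _)).trans ?_
    have e1 : |T.height Ω δ v ζ - T.height Ω δ v ζ'| ≤ √2 * ‖ζ - ζ'‖ :=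
      (abs_height_sub_le v ζ ζ').trans (by gcongr; exact norm_le_pi_norm (ζ - ζ') v)
    have e2 := abs_denom_sub_le (T := T) (Ω := Ω) (δ := δ) (T.parent v) ζ ζ'
    calc _ ≤ δ⁻¹ * (√2 * ‖ζ - ζ'‖) + K * ‖ζ - ζ'‖ +
          δ⁻¹ * ((Fintype.card V + 1) * √2 * ‖ζ - ζ'‖) := by
          gcongr
          exact h ζ ζ'
      _ = _ := by ring

/-- The `ℓ¹` Lipschitz estimate for the speeds of the children of a vertex. -/
lemma sum_abs_speed_sub_le (hδ : 0 < δ) (v : V) {ζ ζ' : V → ℝ × ℂ} (hv : ζ v = ζ' v)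
    (hs : T.speed Ω δ v ζ = T.speed Ω δ v ζ') :
    ∑ u ∈ T.children v, |T.speed Ω δ u ζ - T.speed Ω δ u ζ'| ≤
      2 * √2 * δ⁻¹ * ∑ u ∈ T.children v, ‖ζ u - ζ' u‖ := by
  set S := ∑ u ∈ T.children v, T.height Ω δ u ζ with hS
  set S' := ∑ u ∈ T.children v, T.height Ω δ u ζ' with hS'
  set D := T.denom Ω δ v ζ with hD
  set D' := T.denom Ω δ v ζ' with hD'
  set R := ∑ u ∈ T.children v, |T.height Ω δ u ζ - T.height Ω δ u ζ'| with hR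
  set g := T.speed Ω δ v ζ with hg
  have hg0 : 0 ≤ g := speed_nonneg hδ.le v ζ
  have hRle : R ≤ √2 * ∑ u ∈ T.children v, ‖ζ u - ζ' u‖ := by
    rw [Finset.mul_sum]
    exact Finset.sum_le_sum fun u _ => abs_height_sub_le u ζ ζ'
  have hSS : |S - S'| ≤ R := abs_sum_height_sub_le v ζ ζ'
  -- The second entry of the maximum is the same for `ζ` and `ζ'`, so only the sum over the children
  -- contributes.
  have hDD : |D - D'| ≤ R := by
    refine (abs_max_sub_max_le_max _ _ _ _).trans (max_le hSS ?_)
    rw [height_congr hv, sub_self, abs_zero]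
    exact Finset.sum_nonneg fun _ _ => abs_nonneg _
  rcases (speed_nonneg hδ.le v ζ).eq_or_lt with h0 | h0
  · have : ∀ u ∈ T.children v, |T.speed Ω δ u ζ - T.speed Ω δ u ζ'| = 0 := fun u hu => by
      rw [speed_of_mem_children hu, speed_of_mem_children hu, ← hs, ← hg, hg, ← h0]
      simp
    rw [Finset.sum_eq_zero this]
    positivity
  have hgD : g ≤ δ⁻¹ * D := speed_le_denom hδ v ζ
  have hgD' : g ≤ δ⁻¹ * D' := hs ▸ speed_le_denom hδ v ζ'
  have hDpos : 0 < D := pos_of_mul_pos_right (h0.trans_le hgD) (inv_nonneg.2 hδ.le)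
  have hDpos' : 0 < D' := pos_of_mul_pos_right (h0.trans_le hgD') (inv_nonneg.2 hδ.le)
  -- One contribution comes from the numerator and one from the denominator. After summation each is
  -- at most `δ⁻¹ R`, whence the factor `2` in the rate.
  have hterm : ∀ u ∈ T.children v, |T.speed Ω δ u ζ - T.speed Ω δ u ζ'| ≤
      g / D * (|T.height Ω δ u ζ - T.height Ω δ u ζ'| +
        T.height Ω δ u ζ' * (|D - D'| / D')) := by
    intro u hu
    have hu0 := height_nonneg (T := T) (Ω := Ω) hδ.le u ζ'
    rw [speed_of_mem_children hu, speed_of_mem_children hu, ← hs]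
    have : g * (T.height Ω δ u ζ / D) - g * (T.height Ω δ u ζ' / D') =
        g / D * ((T.height Ω δ u ζ - T.height Ω δ u ζ') -
          T.height Ω δ u ζ' * ((D - D') / D')) := by
      field_simp
      ring
    rw [this, abs_mul, abs_of_nonneg (by positivity : 0 ≤ g / D)]
    gcongr
    refine (abs_sub _ _).trans ?_
    rw [abs_mul, abs_div, abs_of_nonneg hu0, abs_of_pos hDpos']
  refine (Finset.sum_le_sum hterm).trans ?_
  rw [← Finset.mul_sum, Finset.sum_add_distrib, ← Finset.sum_mul]
  have hS'D' : S' * (|D - D'| / D') ≤ R := by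
    have : S' ≤ D' := le_max_left _ _
    calc S' * (|D - D'| / D') ≤ D' * (|D - D'| / D') := by gcongr
      _ = |D - D'| := by field_simp
      _ ≤ R := hDD
  have hR0 : 0 ≤ R := Finset.sum_nonneg fun _ _ => abs_nonneg _
  have hS'0 : 0 ≤ S' := Finset.sum_nonneg fun u _ => height_nonneg hδ.le u ζ'
  calc g / D * (R + S' * (|D - D'| / D')) ≤ δ⁻¹ * (R + R) := by
        gcongr
        exact (div_le_iff₀ hDpos).2 hgD
    _ ≤ δ⁻¹ * (√2 * ∑ u ∈ T.children v, ‖ζ u - ζ' u‖ + √2 * ∑ u ∈ T.children v, ‖ζ u - ζ' u‖) := by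
        gcongr
    _ = _ := by ring

/-- The speeds of the children of `v` add up to that of `v` on the face `∑ ζ_u = ζ_v`. -/
lemma abs_speed_sub_sum_le (hδ : 0 < δ) {v : V} (hv : ¬ T.IsLeaf v) {ζ : V → ℝ × ℂ}
    (hh : T.height Ω δ v ζ ≤ (T.dfsAt Ω v).eta (ζ v)) :
    |T.speed Ω δ v ζ - ∑ u ∈ T.children v, T.speed Ω δ u ζ| ≤
      √2 * δ⁻¹ * ‖ζ v - ∑ u ∈ T.children v, ζ u‖ := by
  rw [abs_of_nonneg (sub_nonneg.2 (sum_speed_children_le hδ.le v ζ)), sum_speed_children]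
  set S := ∑ u ∈ T.children v, T.height Ω δ u ζ with hS
  set D := T.denom Ω δ v ζ with hD
  have hgD : T.speed Ω δ v ζ ≤ δ⁻¹ * D := speed_le_denom hδ v ζ
  have hg0 := speed_nonneg (T := T) (Ω := Ω) hδ.le v ζ
  rcases hg0.eq_or_lt with h0 | h0
  · rw [← h0, zero_mul, sub_zero]
    positivity
  have hDpos : 0 < D := pos_of_mul_pos_right (h0.trans_le hgD) (inv_nonneg.2 hδ.le)
  -- The denominator exceeds the sum `S` of the heights only if the height of `v` does, and by
  -- subadditivity the excess is at most the defect.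
  have hle : D - S ≤ √2 * ‖ζ v - ∑ u ∈ T.children v, ζ u‖ := by
    have h1 : (T.dfsAt Ω v).eta (ζ v) ≤ S + √2 * ‖ζ v - ∑ u ∈ T.children v, ζ u‖ := by
      have h2 := Ω.eta_convPow_sum_le (T.children v) T.weight ζ (ζ v)
      rw [← T.weight_eq_sum_children hv] at h2
      refine h2.trans_eq ?_
      congr 1
      exact Finset.sum_congr rfl fun u hu => (height_of_ne (T.mem_children.1 hu).1 ζ).symm
    have h3 : D ≤ S + √2 * ‖ζ v - ∑ u ∈ T.children v, ζ u‖ :=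
      max_le (le_add_of_nonneg_right (by positivity)) (hh.trans h1)
    linarith
  calc T.speed Ω δ v ζ - T.speed Ω δ v ζ * (S / D) = T.speed Ω δ v ζ / D * (D - S) := by
        field_simp
    _ ≤ T.speed Ω δ v ζ / D * (√2 * ‖ζ v - ∑ u ∈ T.children v, ζ u‖) := by gcongr
    _ ≤ δ⁻¹ * (√2 * ‖ζ v - ∑ u ∈ T.children v, ζ u‖) := by
        gcongr
        exact (div_le_iff₀ hDpos).2 hgD
    _ = _ := by ring

end IterationDiagram

/-- The reason for the maximum norm: recording the length beside the position does not increase the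
norm of the velocity. -/
lemma norm_smul_norm_prodMk (c : ℝ) (w : ℂ) : ‖c • ((‖w‖, w) : ℝ × ℂ)‖ = |c| * ‖w‖ := by
  rw [norm_smul, Prod.norm_mk, norm_norm, max_self, Real.norm_eq_abs]

/-! ### Flow lines: existence, dependence on initial values, invariants -/

namespace IterationDiagram

variable {V : Type*} [Fintype V]

/-- `Z` is an integral curve over `[a,1]` of the vector field `speed_v(ζ) (‖h(t)‖, h(t))`. -/
def IsFlowLine (T : IterationDiagram V) (Ω : DFS) (δ : ℝ) (h : ℝ → ℂ) (a : ℝ)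
    (Z : ℝ → V → ℝ × ℂ) : Prop :=
  ∀ t ∈ Icc a 1, ∀ v, HasDerivWithinAt (fun t => Z t v)
    (T.speed Ω δ v (Z t) • ((‖h t‖, h t) : ℝ × ℂ)) (Icc a 1) t

variable (T : IterationDiagram V) (Ω : DFS) {δ : ℝ} {h : ℝ → ℂ} {a : ℝ}

lemma exists_forall_abs_speed_sub_le (hδ : 0 < δ) : ∃ K : ℝ, 0 ≤ K ∧ ∀ v ζ ζ',
    |T.speed Ω δ v ζ - T.speed Ω δ v ζ'| ≤ K * ‖ζ - ζ'‖ := by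
  choose K hK h using fun v => exists_abs_speed_sub_le (T := T) (Ω := Ω) hδ v
  refine ⟨∑ v, K v, Finset.sum_nonneg fun v _ => hK v, fun v ζ ζ' => (h v ζ ζ').trans ?_⟩
  gcongr
  exact Finset.single_le_sum (f := K) (fun v _ => hK v) (Finset.mem_univ v)

lemma exists_isFlowLine (hδ : 0 < δ) (hh : ContinuousOn h (Icc a 1)) (ha : a ≤ 1)
    (z : V → ℝ × ℂ) : ∃ Z, IsFlowLine T Ω δ h a Z ∧ Z a = z := by
  obtain ⟨K, hK, hKle⟩ := T.exists_forall_abs_speed_sub_le Ω hδ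
  obtain ⟨M, hM⟩ := isCompact_Icc.exists_bound_of_continuousOn hh
  have hM0 : 0 ≤ M := (norm_nonneg _).trans (hM a (left_mem_Icc.2 ha))
  set F : ℝ → (V → ℝ × ℂ) → V → ℝ × ℂ := fun t ζ v =>
    T.speed Ω δ v ζ • ((‖h t‖, h t) : ℝ × ℂ) with hF
  -- Speeds are at most `1`, so a solution moves by at most `M (1 - a)`; a ball of this radius
  -- covers the whole interval.
  have hPL : IsPicardLindelof F (⟨a, left_mem_Icc.2 ha⟩ : Icc a 1) z
      (M.toNNReal * (1 - a).toNNReal) 0 M.toNNReal (K * M).toNNReal := by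
    refine ⟨fun t ht => ?_, fun ζ _ => ?_, fun t ht ζ _ => ?_, ?_⟩
    · refine (LipschitzWith.of_dist_le_mul fun ζ ζ' => ?_).lipschitzOnWith
      rw [dist_eq_norm, dist_eq_norm, Real.coe_toNNReal _ (by positivity)]
      refine (pi_norm_le_iff_of_nonneg (by positivity)).2 fun v => ?_
      simp only [Pi.sub_apply, hF]
      rw [← sub_smul, norm_smul_norm_prodMk]
      calc _ ≤ K * ‖ζ - ζ'‖ * M := by
            gcongr
            exacts [hKle _ _ _, hM t ht]
        _ = _ := by ring
    · exact continuousOn_pi.2 fun v => (hh.norm.prodMk hh).const_smul (T.speed Ω δ v ζ)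
    · rw [Real.coe_toNNReal _ hM0]
      refine (pi_norm_le_iff_of_nonneg hM0).2 fun v => ?_
      simp only [hF]
      rw [norm_smul_norm_prodMk, abs_of_nonneg (speed_nonneg hδ.le v ζ)]
      exact (mul_le_of_le_one_left (norm_nonneg _) (speed_le_one hδ.le v ζ)).trans (hM t ht)
    · simp [sub_nonneg.2 ha]
  obtain ⟨Z, hZa, hZ⟩ := hPL.exists_eq_forall_mem_Icc_hasDerivWithinAt₀
  exact ⟨Z, fun t ht v => hasDerivWithinAt_pi.1 (hZ t ht) v, hZa⟩

variable {T Ω} {Z Z' : ℝ → V → ℝ × ℂ}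

namespace IsFlowLine

lemma continuousOn (hZ : IsFlowLine T Ω δ h a Z) (v : V) :
    ContinuousOn (fun t => Z t v) (Icc a 1) := fun t ht => (hZ t ht v).continuousWithinAt

/-- Lipschitz dependence on the initial values, for the coordinates in a set of vertices that
determines its own evolution. -/
lemma exists_norm_indicator_sub_le (T : IterationDiagram V) (Ω : DFS) (hδ : 0 < δ)
    (hh : ContinuousOn h (Icc a 1)) (ha : a ≤ 1) :
    ∃ C : ℝ, 0 ≤ C ∧ ∀ S : Set V, (∀ v ∈ S, T.depSet v ⊆ S) →
      ∀ Z Z', IsFlowLine T Ω δ h a Z → IsFlowLine T Ω δ h a Z' → ∀ t ∈ Icc a 1,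
        ‖S.indicator (Z t) - S.indicator (Z' t)‖ ≤
          C * ‖S.indicator (Z a) - S.indicator (Z' a)‖ := by
  obtain ⟨K, hK, hKle⟩ := T.exists_forall_abs_speed_sub_le Ω hδ
  obtain ⟨M, hM⟩ := isCompact_Icc.exists_bound_of_continuousOn hh
  have hM0 : 0 ≤ M := (norm_nonneg _).trans (hM a (left_mem_Icc.2 ha))
  refine ⟨Real.exp (K * M * (1 - a)), (Real.exp_pos _).le, fun S hS Z Z' hZ hZ' t ht => ?_⟩
  -- The speeds in `S` read only coordinates in `S`, so replacing the others by zero leaves a closed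
  -- system.
  have hsp : ∀ v ∈ S, ∀ ζ : V → ℝ × ℂ, T.speed Ω δ v ζ = T.speed Ω δ v (S.indicator ζ) :=
    fun v hv ζ => speed_congr v fun u hu => (indicator_of_mem (hS v hv hu) ζ).symm
  have hind : ∀ (Z : ℝ → V → ℝ × ℂ), IsFlowLine T Ω δ h a Z → ∀ t ∈ Icc a 1,
      HasDerivWithinAt (fun t => S.indicator (Z t))
        (S.indicator fun v => T.speed Ω δ v (Z t) • ((‖h t‖, h t) : ℝ × ℂ)) (Icc a 1) t := by
    intro Z hZ t ht
    refine hasDerivWithinAt_pi.2 fun v => ?_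
    by_cases hv : v ∈ S
    · simp only [indicator_of_mem hv]
      exact hZ t ht v
    · simp only [indicator_of_notMem hv]
      exact hasDerivWithinAt_const _ _ _
  have hG := norm_le_mul_exp_of_norm_deriv_le
    (Y := fun t => S.indicator (Z t) - S.indicator (Z' t))
    (P := fun t => K * M * t) (k := fun _ => K * M)
    (fun t ht => (hind Z hZ t ht).sub (hind Z' hZ' t ht))
    (fun t _ => by simpa using (hasDerivWithinAt_id t (Icc a 1)).const_mul (K * M)) ?_ ht
  · refine hG.trans ?_
    rw [mul_comm, ← mul_sub]
    have := ht.2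
    gcongr
  · intro t ht
    refine (pi_norm_le_iff_of_nonneg (by positivity)).2 fun v => ?_
    by_cases hv : v ∈ S
    · simp only [Pi.sub_apply, indicator_of_mem hv]
      rw [← sub_smul, norm_smul_norm_prodMk, hsp v hv (Z t), hsp v hv (Z' t)]
      calc _ ≤ K * ‖S.indicator (Z t) - S.indicator (Z' t)‖ * M := by
            gcongr
            exacts [hKle _ _ _, hM t ht]
        _ = _ := by ring
    · simp only [Pi.sub_apply, indicator_of_notMem hv, sub_self, norm_zero]
      positivity

lemma eq_of_depSet (hδ : 0 < δ) (hh : ContinuousOn h (Icc a 1)) (hZ : IsFlowLine T Ω δ h a Z)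
    (hZ' : IsFlowLine T Ω δ h a Z') {v : V} (hv : ∀ u ∈ T.depSet v, Z a u = Z' a u) {t : ℝ}
    (ht : t ∈ Icc a 1) : Z t v = Z' t v := by
  obtain ⟨C, -, hC⟩ := exists_norm_indicator_sub_le T Ω hδ hh (ht.1.trans ht.2)
  have h1 := hC (T.depSet v) (fun u hu => T.depSet_subset_of_mem hu) Z Z' hZ hZ' t ht
  have h0 : (T.depSet v).indicator (Z a) = (T.depSet v).indicator (Z' a) :=
    indicator_congr hv
  rw [h0, sub_self, norm_zero, mul_zero] at h1
  have h2 := congrFun (sub_eq_zero.1 (norm_le_zero_iff.1 h1)) v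
  rwa [indicator_of_mem (T.self_mem_depSet v), indicator_of_mem (T.self_mem_depSet v)] at h2

variable {P : ℝ → ℝ}

/-- The `ℓ¹` estimate for the dependence of the children of `v` on their initial values. -/
lemma sum_norm_sub_le (hδ : 0 < δ) (hh : ContinuousOn h (Icc a 1))
    (hP : ∀ t ∈ Icc a 1, HasDerivWithinAt P ‖h t‖ (Icc a 1) t)
    (hZ : IsFlowLine T Ω δ h a Z) (hZ' : IsFlowLine T Ω δ h a Z') {v : V}
    (hv : ∀ u ∈ T.depSet v, Z a u = Z' a u) {t : ℝ} (ht : t ∈ Icc a 1) :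
    ∑ u ∈ T.children v, ‖Z t u - Z' t u‖ ≤
      (∑ u ∈ T.children v, ‖Z a u - Z' a u‖) *
        Real.exp (2 * √2 * δ⁻¹ * P t - 2 * √2 * δ⁻¹ * P a) := by
  have hnorm : ∀ f : V → ℝ × ℂ, ‖WithLp.toLp 1 (fun u : T.children v => f u)‖ =
      ∑ u ∈ T.children v, ‖f u‖ := fun f => by
    rw [PiLp.norm_eq_of_L1]
    exact Finset.sum_coe_sort (T.children v) fun u => ‖f u‖
  -- In the `ℓ¹` norm over the children the rate is independent of their number.
  have hG := norm_le_mul_exp_of_norm_deriv_le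
    (Y := fun t => WithLp.toLp 1 (fun u : T.children v => Z t u - Z' t u))
    (Y' := fun t => WithLp.toLp 1 (fun u : T.children v =>
      (T.speed Ω δ u (Z t) - T.speed Ω δ u (Z' t)) • ((‖h t‖, h t) : ℝ × ℂ)))
    (P := fun t => 2 * √2 * δ⁻¹ * P t) (k := fun t => 2 * √2 * δ⁻¹ * ‖h t‖)
    (fun t ht => ?_) (fun t ht => (hP t ht).const_mul _) (fun t ht => ?_) ht
  · rwa [hnorm fun u => Z t u - Z' t u, hnorm fun u => Z a u - Z' a u] at hG
  · have h1 : HasDerivWithinAt (fun t => fun u : T.children v => Z t u - Z' t u)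
        (fun u : T.children v =>
          (T.speed Ω δ u (Z t) - T.speed Ω δ u (Z' t)) • ((‖h t‖, h t) : ℝ × ℂ)) (Icc a 1) t :=
      hasDerivWithinAt_pi.2 fun u => by
        simp only [sub_smul]
        exact (hZ t ht u).sub (hZ' t ht u)
    exact (PiLp.continuousLinearEquiv 1 ℝ
      (fun _ : T.children v => ℝ × ℂ)).symm.hasFDerivAt.comp_hasDerivWithinAt t h1
  · rw [hnorm fun u => (T.speed Ω δ u (Z t) - T.speed Ω δ u (Z' t)) • ((‖h t‖, h t) : ℝ × ℂ),
      hnorm fun u => Z t u - Z' t u]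
    simp only [norm_smul_norm_prodMk]
    rw [← Finset.sum_mul]
    -- The subsystem `W_v` evolves identically on both flow lines, so `v` and its speed agree and
    -- only the children differ.
    have heq : ∀ u ∈ T.depSet v, Z t u = Z' t u := fun u hu =>
      eq_of_depSet hδ hh hZ hZ' (fun w hw => hv w (T.depSet_subset_of_mem hu hw)) ht
    have := sum_abs_speed_sub_le (Ω := Ω) hδ v (heq v (T.self_mem_depSet v)) (speed_congr v heq)
    calc _ ≤ (2 * √2 * δ⁻¹ * ∑ u ∈ T.children v, ‖Z t u - Z' t u‖) * ‖h t‖ := by gcongr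
      _ = _ := by ring

/-- Working with one point `p` at a time avoids differentiating a distance function. The hypothesis
on the height has content at the root only. -/
lemma norm_deriv_le (hδ : 0 < δ) {v : V}
    (hv : ∀ t ∈ Icc a 1, T.height Ω δ v (Z t) ≤ (T.dfsAt Ω v).eta (Z t v))
    {p : WithLp 2 (ℝ × ℂ)} (hp : p ∈ (T.dfsAt Ω v).pointedSet) :
    ∀ t ∈ Icc a 1, ‖T.speed Ω δ v (Z t) • ((‖h t‖, h t) : ℝ × ℂ)‖ ≤
      √2 * δ⁻¹ * ‖h t‖ * ‖Z t v - p.ofLp‖ := by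
  intro t ht
  rw [norm_smul_norm_prodMk, abs_of_nonneg (speed_nonneg hδ.le _ _)]
  calc _ ≤ δ⁻¹ * (√2 * ‖Z t v - p.ofLp‖) * ‖h t‖ := by
        gcongr
        refine (speed_le_height hδ v (Z t)).trans ?_
        gcongr
        exact (hv t ht).trans (DFS.eta_le_of_mem _ _ hp)
    _ = _ := by ring

lemma mul_exp_le_norm_sub (hδ : 0 < δ) (hP : ∀ t ∈ Icc a 1, HasDerivWithinAt P ‖h t‖ (Icc a 1) t)
    (hZ : IsFlowLine T Ω δ h a Z) {v : V}
    (hv : ∀ t ∈ Icc a 1, T.height Ω δ v (Z t) ≤ (T.dfsAt Ω v).eta (Z t v))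
    {p : WithLp 2 (ℝ × ℂ)} (hp : p ∈ (T.dfsAt Ω v).pointedSet) {t : ℝ} (ht : t ∈ Icc a 1) :
    ‖Z a v - p.ofLp‖ * Real.exp (-(√2 * δ⁻¹ * P t - √2 * δ⁻¹ * P a)) ≤ ‖Z t v - p.ofLp‖ :=
  mul_exp_le_norm_of_norm_deriv_le (Y := fun t => Z t v - p.ofLp)
    (P := fun t => √2 * δ⁻¹ * P t) (k := fun t => √2 * δ⁻¹ * ‖h t‖)
    (fun t ht => (hZ t ht v).sub_const _) (fun t ht => (hP t ht).const_mul _)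
    (norm_deriv_le hδ hv hp) ht

/-- The upper Grönwall bound with `p = 0`. The root is excluded because its height is the constant
`δ`. -/
lemma eq_zero (hδ : 0 < δ) (hP : ∀ t ∈ Icc a 1, HasDerivWithinAt P ‖h t‖ (Icc a 1) t)
    (hZ : IsFlowLine T Ω δ h a Z) {v : V} (hv : v ≠ T.root) (h0 : Z a v = 0) {t : ℝ}
    (ht : t ∈ Icc a 1) : Z t v = 0 := by
  have hG := norm_le_mul_exp_of_norm_deriv_le (Y := fun t => Z t v)
    (P := fun t => √2 * δ⁻¹ * P t) (k := fun t => √2 * δ⁻¹ * ‖h t‖)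
    (fun t ht => hZ t ht v) (fun t ht => (hP t ht).const_mul _)
    (fun t ht => by
      simpa using norm_deriv_le (h := h) hδ (v := v) (Z := Z) (fun t _ => (height_of_ne hv _).le)
        (DFS.zero_mem_pointedSet _) t ht) ht
  rw [h0, norm_zero, zero_mul] at hG
  exact norm_le_zero_iff.1 hG

lemma sum_children_eq (hδ : 0 < δ) (hP : ∀ t ∈ Icc a 1, HasDerivWithinAt P ‖h t‖ (Icc a 1) t)
    (hZ : IsFlowLine T Ω δ h a Z) {v : V} (hleaf : ¬ T.IsLeaf v)
    (hv : ∀ t ∈ Icc a 1, T.height Ω δ v (Z t) ≤ (T.dfsAt Ω v).eta (Z t v))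
    (h0 : ∑ u ∈ T.children v, Z a u = Z a v) {t : ℝ} (ht : t ∈ Icc a 1) :
    ∑ u ∈ T.children v, Z t u = Z t v := by
  have hG := norm_le_mul_exp_of_norm_deriv_le
    (Y := fun t => Z t v - ∑ u ∈ T.children v, Z t u)
    (Y' := fun t => (T.speed Ω δ v (Z t) - ∑ u ∈ T.children v, T.speed Ω δ u (Z t)) •
      ((‖h t‖, h t) : ℝ × ℂ))
    (P := fun t => √2 * δ⁻¹ * P t) (k := fun t => √2 * δ⁻¹ * ‖h t‖)
    (fun t ht => by
      rw [sub_smul, Finset.sum_smul]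
      exact (hZ t ht v).sub (HasDerivWithinAt.fun_sum fun u _ => hZ t ht u))
    (fun t ht => (hP t ht).const_mul _)
    (fun t ht => by
      rw [norm_smul_norm_prodMk]
      calc _ ≤ √2 * δ⁻¹ * ‖Z t v - ∑ u ∈ T.children v, Z t u‖ * ‖h t‖ := by
            gcongr
            exact abs_speed_sub_sum_le hδ hleaf (hv t ht)
        _ = _ := by ring) ht
  rw [h0, sub_self, norm_zero, zero_mul] at hG
  exact (sub_eq_zero.1 (norm_le_zero_iff.1 hG)).symm

lemma hasDerivWithinAt_fst (hZ : IsFlowLine T Ω δ h a Z) (v : V) {t : ℝ} (ht : t ∈ Icc a 1) :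
    HasDerivWithinAt (fun t => (Z t v).1) (T.speed Ω δ v (Z t) * ‖h t‖) (Icc a 1) t :=
  (ContinuousLinearMap.fst ℝ ℝ ℂ).hasFDerivAt.comp_hasDerivWithinAt t (hZ t ht v)

lemma fst_le_fst (hδ : 0 < δ) (hZ : IsFlowLine T Ω δ h a Z) (v : V) {t : ℝ} (ht : t ∈ Icc a 1) :
    (Z a v).1 ≤ (Z t v).1 :=
  image_le_of_deriv_right_le_deriv_boundary (f := fun _ => (Z a v).1) (f' := fun _ => 0)
    continuousOn_const (fun x _ => hasDerivWithinAt_const x _ _) le_rfl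
    (hZ.continuousOn v).fst
    (fun _ hx => (hZ.hasDerivWithinAt_fst v (Ico_subset_Icc_self hx)).Ici_of_Icc hx)
    (fun _ _ => mul_nonneg (speed_nonneg hδ.le _ _) (norm_nonneg _)) ht

/-- First coordinates are path lengths; this lets the lengths at time `t`, divided by that of the
root, form a point of `Δ_T`. -/
lemma sum_fst_le (hδ : 0 < δ) (hZ : IsFlowLine T Ω δ h a Z) (v : V)
    (h0 : ∑ u ∈ T.children v, (Z a u).1 ≤ (Z a v).1) {t : ℝ} (ht : t ∈ Icc a 1) :
    ∑ u ∈ T.children v, (Z t u).1 ≤ (Z t v).1 :=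
  image_le_of_deriv_right_le_deriv_boundary (f := fun t => ∑ u ∈ T.children v, (Z t u).1)
    (f' := fun t => ∑ u ∈ T.children v, T.speed Ω δ u (Z t) * ‖h t‖)
    (continuousOn_finsetSum _ fun u _ => (hZ.continuousOn u).fst)
    (fun x hx => HasDerivWithinAt.fun_sum fun u _ =>
      (hZ.hasDerivWithinAt_fst u (Ico_subset_Icc_self hx)).Ici_of_Icc hx) h0
    (hZ.continuousOn v).fst
    (fun x hx => (hZ.hasDerivWithinAt_fst v (Ico_subset_Icc_self hx)).Ici_of_Icc hx)
    (fun x _ => by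
      rw [← Finset.sum_mul]
      gcongr
      exact sum_speed_children_le hδ.le v _) ht

lemma root_eq (hZ : IsFlowLine T Ω δ h a Z) {γ : ℝ → ℂ}
    (hP : ∀ t ∈ Icc a 1, HasDerivWithinAt P ‖h t‖ (Icc a 1) t)
    (hγ : ∀ t ∈ Icc a 1, HasDerivWithinAt γ (h t) (Icc a 1) t) {t : ℝ} (ht : t ∈ Icc a 1) :
    Z t T.root - Z a T.root = (P t - P a, γ t - γ a) := by
  have hd : ∀ t ∈ Icc a 1, HasDerivWithinAt (fun t => Z t T.root - (P t, γ t)) 0 (Icc a 1) t := by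
    intro t ht
    have h1 := (hZ t ht T.root).sub ((hP t ht).prodMk (hγ t ht))
    rwa [speed_root, one_smul, sub_self] at h1
  have := constant_of_has_deriv_right_zero (fun t ht => (hd t ht).continuousWithinAt)
    (fun t ht => (hd t (Ico_subset_Icc_self ht)).Ici_of_Icc ht) t ht
  rw [← Prod.mk_sub_mk]
  rw [sub_eq_sub_iff_add_eq_add] at this ⊢
  rw [this, add_comm]

end IsFlowLine

end IterationDiagram

/-! ### Path lengths, and lifts to endless surfaces -/

section PathLength

lemma pathLength_congr {γ γ' : ℝ → ℂ} {t : ℝ} (h : EqOn γ γ' (Icc 0 t)) :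
    pathLength γ t = pathLength γ' t := by
  rw [pathLength, pathLength, eVariationOn.congr h]

lemma pathLength_comp_mul (γ : ℝ → ℂ) {c : ℝ} (hc : 0 < c) (t : ℝ) :
    pathLength (fun τ => γ (c * τ)) t = pathLength γ (c * t) := by
  have h := eVariationOn.comp_eq_of_monotoneOn γ (t := Icc 0 t) (fun τ => c * τ)
    fun x _ y _ hxy => mul_le_mul_of_nonneg_left hxy hc.le
  have him : (fun τ => c * τ) '' Icc 0 t = Icc 0 (c * t) := by
    rw [Set.image_mul_left_Icc' hc, mul_zero]
  rw [him] at h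
  rw [pathLength, pathLength, ← h]
  rfl

/-- A curve in `ℝ × ℂ` whose first component has the speed of the second one is
`t ↦ (L(γ|_t), γ(t))`. -/
lemma pathLength_snd_eq_fst {W : ℝ → ℝ × ℂ} {φ : ℝ → ℂ} (hc : ContinuousOn W (Icc 0 1))
    (hW : ∀ t ∈ Ico (0 : ℝ) 1, HasDerivWithinAt W (‖φ t‖, φ t) (Ici t) t) (h0 : (W 0).1 = 0)
    {t : ℝ} (ht : t ∈ Icc (0 : ℝ) 1) : pathLength (fun t => (W t).2) t = (W t).1 := by
  have hsub : Icc 0 t ⊆ Icc 0 1 := Icc_subset_Icc_right ht.2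
  have hfst : ∀ x ∈ Ico 0 t, HasDerivWithinAt (fun t => (W t).1) ‖φ x‖ (Ici x) x := fun x hx =>
    (ContinuousLinearMap.fst ℝ ℝ ℂ).hasFDerivAt.comp_hasDerivWithinAt x
      (hW x ⟨hx.1, hx.2.trans_le ht.2⟩)
  have hsnd : ∀ x ∈ Ico 0 t, HasDerivWithinAt (fun t => (W t).2) (φ x) (Ici x) x := fun x hx =>
    (ContinuousLinearMap.snd ℝ ℝ ℂ).hasFDerivAt.comp_hasDerivWithinAt x
      (hW x ⟨hx.1, hx.2.trans_le ht.2⟩)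
  have hnn : 0 ≤ (W t).1 := h0 ▸ image_le_of_deriv_right_le_deriv_boundary
    (f := fun _ => (W 0).1) (f' := fun _ => 0) continuousOn_const
    (fun x _ => hasDerivWithinAt_const x _ _) le_rfl (hc.mono hsub).fst hfst
    (fun x _ => norm_nonneg _) ⟨ht.1, le_rfl⟩
  rw [pathLength, eVariationOn_Icc_eq_of_hasDerivWithinAt (G := fun t => (W t).1) ht.1
    (hc.mono hsub).snd (hc.mono hsub).fst hsnd hfst, h0, sub_zero, ENNReal.toReal_ofReal hnn]

end PathLength

namespace DFS

lemma allowedPaths_congr {Ω : DFS} {γ γ' : ℝ → ℂ} (h : EqOn γ γ' (Icc 0 1))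
    (hγ : γ ∈ Ω.allowedPaths) : γ' ∈ Ω.allowedPaths := by
  obtain ⟨⟨⟨K, hK⟩, h0⟩, hS⟩ := hγ
  refine ⟨⟨⟨K, fun x hx y hy => ?_⟩, ?_⟩, fun t ht => ?_⟩
  · rw [← h hx, ← h hy]
    exact hK hx hy
  · rw [← h (left_mem_Icc.2 zero_le_one), h0]
  · have := hS t ht
    rwa [liftedPoint, pathLength_congr (h.mono (Icc_subset_Icc_right ht.2)), h ht] at this

end DFS

namespace EndlessSurface

variable {Ω : DFS} (X : EndlessSurface Ω)

lemma lift_congr {γ γ' : ℝ → ℂ} (hγ : γ ∈ Ω.allowedPaths) (h : EqOn γ γ' (Icc 0 1)) :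
    EqOn (X.lift γ) (X.lift γ') (Icc 0 1) := by
  obtain ⟨hc, h0, hp⟩ := X.lift_spec hγ
  exact X.lift_unique (DFS.allowedPaths_congr h hγ) hc h0 fun t ht => (hp t ht).trans (h ht)

lemma lift_comp_mul {γ : ℝ → ℂ} (hγ : γ ∈ Ω.allowedPaths) {c : ℝ} (hc : c ∈ Icc (0 : ℝ) 1)
    (hγc : (fun τ => γ (c * τ)) ∈ Ω.allowedPaths) :
    X.lift (fun τ => γ (c * τ)) 1 = X.lift γ c := by
  obtain ⟨hcont, h0, hp⟩ := X.lift_spec hγ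
  have hmaps : MapsTo (fun τ => c * τ) (Icc 0 1) (Icc 0 1) := fun τ hτ =>
    ⟨mul_nonneg hc.1 hτ.1, mul_le_one₀ hc.2 hτ.1 hτ.2⟩
  have := X.lift_unique hγc (g := fun τ => X.lift γ (c * τ))
    (hcont.comp (by fun_prop) hmaps) (by rw [mul_zero, h0]) (fun t ht => hp _ (hmaps ht))
    (right_mem_Icc.2 zero_le_one)
  simpa using this.symm

/-- The lifts of a continuous family of allowed paths depend continuously on the parameter. -/
lemma continuousOn_lift {A : Type*} [TopologicalSpace A] {F : A → ℝ → ℂ} {S : Set A}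
    (hF : ContinuousOn (fun q : ℝ × A => F q.2 q.1) (Icc 0 1 ×ˢ S))
    (hall : ∀ x ∈ S, F x ∈ Ω.allowedPaths) :
    ContinuousOn (fun q : ℝ × A => X.lift (F q.2) q.1) (Icc 0 1 ×ˢ S) := by
  have hF' : Continuous fun q : unitInterval × S => F q.2 q.1 := by
    refine hF.comp_continuous (f := fun q : unitInterval × S => ((q.1 : ℝ), (q.2 : A)))
      (by fun_prop) fun q => ⟨q.1.2, q.2.2⟩
  -- For a separated local homeomorphism, a lift that is continuous in time for each parameter and
  -- continuous in the parameter at time `0` is jointly continuous.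
  have hlift := X.proj_local.isLocalHomeomorph.continuous_lift (T2Space.isSeparatedMap _)
    ⟨_, hF'⟩ (g := fun q : unitInterval × S => X.lift (F q.2) q.1)
    (funext fun q => (X.lift_spec (hall _ q.2.2)).2.2 _ q.1.2)
    (by
      have : ∀ x : S, X.lift (F x) ((0 : unitInterval) : ℝ) = X.base := fun x =>
        (X.lift_spec (hall _ x.2)).2.1
      simp only [this]
      exact continuous_const)
    (fun x => (X.lift_spec (hall _ x.2)).1.comp_continuous continuous_subtype_val fun t => t.2)
  rw [continuousOn_iff_continuous_domRestrict]
  exact hlift.comp (f := fun q : ↥(Icc (0 : ℝ) 1 ×ˢ S) =>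
    ((⟨q.1.1, q.2.1⟩, ⟨q.1.2, q.2.2⟩) : unitInterval × S)) (by fun_prop)

end EndlessSurface

section LengthFrom

variable {γ : ℝ → ℂ} {a : ℝ}

lemma lengthFrom_self : lengthFrom γ a a = 0 := intervalIntegral.integral_same

lemma lengthFrom_nonneg {t : ℝ} (ht : a ≤ t) : 0 ≤ lengthFrom γ a t :=
  intervalIntegral.integral_nonneg ht fun _ _ => norm_nonneg _

lemma hasDerivWithinAt_lengthFrom (ha : a < 1) (hγ : ContDiffOn ℝ 1 γ (Icc a 1)) :
    ∀ t ∈ Icc a 1, HasDerivWithinAt (lengthFrom γ a) ‖derivWithin γ (Icc a 1) t‖ (Icc a 1) t := by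
  intro t ht
  have hc : ContinuousOn (fun τ => ‖derivWithin γ (Icc a 1) τ‖) (Icc a 1) :=
    (hγ.continuousOn_derivWithin (uniqueDiffOn_Icc ha) le_rfl).norm
  -- The two derivatives agree in the open interval; at the end points, where `deriv` may take its
  -- default value, they do not affect the integral.
  have heq : ∀ x ∈ Icc a 1, lengthFrom γ a x = ∫ τ in a..x, ‖derivWithin γ (Icc a 1) τ‖ := by
    intro x hx
    refine intervalIntegral.integral_congr_Ioo_of_le hx.1 fun τ hτ => ?_
    rw [derivWithin_of_mem_nhds (Icc_mem_nhds hτ.1 (hτ.2.trans_le hx.2))]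
  have : Fact (t ∈ Icc a 1) := ⟨ht⟩
  refine (intervalIntegral.integral_hasDerivWithinAt_right (s := Icc a 1) (t := Icc a 1)
    ?_ ?_ (hc t ht)).congr heq (heq t ht)
  · exact (hc.mono (by rw [uIcc_of_le ht.1]; exact Icc_subset_Icc_right ht.2)).intervalIntegrable
  · exact hc.stronglyMeasurableAtFilter_nhdsWithin measurableSet_Icc t

end LengthFrom

/-! ### The curves built from the flow, and their admissibility -/

namespace IterationDiagram

variable {V : Type*} [Fintype V]

/-- The points of the unit cube whose coordinate at the root is `1`. -/
def box (T : IterationDiagram V) : Set (V → ℝ) := {s | (∀ v, s v ∈ Icc (0 : ℝ) 1) ∧ s T.root = 1}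

/-- The construction is carried out on the box because varying a single coordinate, as partial
derivatives require, can leave the simplex. -/
lemma simplex_subset_box (T : IterationDiagram V) : T.simplex ⊆ T.box := fun _ hs =>
  ⟨fun v => ⟨hs.1 v, T.le_one_of_mem_simplex hs v⟩, hs.2.2⟩

/-- The data from which the adapted deformation is constructed. -/
structure DeformationData (T : IterationDiagram V) (Ω : DFS) (ρ δ : ℝ) (γ : ℝ → ℂ) (a : ℝ) :
    Prop where
  hρ : 0 < ρ
  hρΩ : ENNReal.ofReal (2 * ρ) < Ω.rho
  hδ : 0 < δ
  hδρ : δ ≤ ρ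
  hdist : ∀ t ∈ Icc (0 : ℝ) 1,
    ENNReal.ofReal δ ≤ Metric.infEDist (liftedPoint γ t) (closure (T.dfsAt Ω T.root).singSet)
  ha : a ∈ Ioo (0 : ℝ) 1
  hC1 : ContDiffOn ℝ 1 γ (Icc a 1)
  hγa : ‖γ a‖ = ρ
  hrad : ∀ t ∈ Icc 0 a, γ t = γ a * ((a⁻¹ * t : ℝ) : ℂ)

namespace DeformationData

variable {T : IterationDiagram V} {Ω : DFS} {ρ δ : ℝ} {γ : ℝ → ℂ} {a : ℝ}
  (D : DeformationData T Ω ρ δ γ a)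

include D

lemma continuousOn_derivWithin : ContinuousOn (derivWithin γ (Icc a 1)) (Icc a 1) :=
  D.hC1.continuousOn_derivWithin (uniqueDiffOn_Icc D.ha.2) le_rfl

lemma hasDerivWithinAt_length : ∀ t ∈ Icc a 1,
    HasDerivWithinAt (lengthFrom γ a) ‖derivWithin γ (Icc a 1) t‖ (Icc a 1) t :=
  hasDerivWithinAt_lengthFrom D.ha.2 D.hC1

lemma hasDerivWithinAt_path : ∀ t ∈ Icc a 1,
    HasDerivWithinAt γ (derivWithin γ (Icc a 1) t) (Icc a 1) t := fun t ht =>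
  ((D.hC1.differentiableOn one_ne_zero) t ht).hasDerivWithinAt

/-- The flow line that starts at the points `(s_v ρ, s_v γ(a))`. -/
noncomputable def flow (s : V → ℝ) : ℝ → V → ℝ × ℂ :=
  (exists_isFlowLine T Ω D.hδ D.continuousOn_derivWithin D.ha.2.le
    (fun v => s v • ((ρ, γ a) : ℝ × ℂ))).choose

lemma isFlowLine (s : V → ℝ) : IsFlowLine T Ω δ (derivWithin γ (Icc a 1)) a (D.flow s) :=
  (exists_isFlowLine T Ω D.hδ D.continuousOn_derivWithin D.ha.2.le
    (fun v => s v • ((ρ, γ a) : ℝ × ℂ))).choose_spec.1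

lemma flow_init (s : V → ℝ) (v : V) : D.flow s a v = s v • ((ρ, γ a) : ℝ × ℂ) :=
  congrFun (exists_isFlowLine T Ω D.hδ D.continuousOn_derivWithin D.ha.2.le
    (fun v => s v • ((ρ, γ a) : ℝ × ℂ))).choose_spec.2 v

lemma norm_init : ‖((ρ, γ a) : ℝ × ℂ)‖ = ρ := by
  rw [Prod.norm_mk, D.hγa, Real.norm_of_nonneg D.hρ.le, max_self]

/-- The curve that consists of a radial segment and of the `v`-component of a flow line. -/
noncomputable def curve (s : V → ℝ) (v : V) (t : ℝ) : ℝ × ℂ :=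
  if t ≤ a then (a⁻¹ * t) • D.flow s a v else D.flow s t v

lemma curve_of_le (s : V → ℝ) (v : V) {t : ℝ} (ht : t ≤ a) :
    D.curve s v t = (a⁻¹ * t) • D.flow s a v := if_pos ht

lemma curve_of_ge (s : V → ℝ) (v : V) {t : ℝ} (ht : a ≤ t) : D.curve s v t = D.flow s t v := by
  rcases ht.eq_or_lt with rfl | ht
  · rw [D.curve_of_le s v le_rfl, inv_mul_cancel₀ D.ha.1.ne', one_smul]
  · exact if_neg ht.not_ge

lemma continuousOn_flow (s : V → ℝ) (v : V) : ContinuousOn (fun t => D.flow s t v) (Icc a 1) :=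
  (D.isFlowLine s).continuousOn v

lemma Icc_zero_one_eq : Icc (0 : ℝ) 1 = Icc 0 a ∪ Icc a 1 :=
  (Icc_union_Icc_eq_Icc D.ha.1.le D.ha.2.le).symm

lemma continuousOn_curve (s : V → ℝ) (v : V) : ContinuousOn (D.curve s v) (Icc 0 1) := by
  rw [D.Icc_zero_one_eq]
  refine ContinuousOn.union_of_isClosed ?_ ?_ isClosed_Icc isClosed_Icc
  · refine ContinuousOn.congr (f := fun t => (a⁻¹ * t) • D.flow s a v) (by fun_prop) ?_
    exact fun t ht => D.curve_of_le s v ht.2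
  · exact (D.continuousOn_flow s v).congr fun t ht => D.curve_of_ge s v ht.1

/-- The velocity has the form `(‖w‖, w)` on the radial part too, since `‖γ a‖ = ρ`. Right
derivatives accommodate the possible corner at `a`. -/
lemma exists_hasDerivWithinAt_curve {s : V → ℝ} {v : V} (hs : 0 ≤ s v) :
    ∃ φ : ℝ → ℂ, ∀ t ∈ Ico (0 : ℝ) 1,
      HasDerivWithinAt (D.curve s v) (‖φ t‖, φ t) (Ici t) t := by
  refine ⟨fun t => if t < a then (a⁻¹ * s v) • γ a else
    T.speed Ω δ v (D.flow s t) • derivWithin γ (Icc a 1) t, fun t ht => ?_⟩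
  dsimp only
  split_ifs with hta
  · have h1 : HasDerivWithinAt (fun t => (a⁻¹ * t) • D.flow s a v) (a⁻¹ • D.flow s a v)
        (Ici t) t := by
      simpa using (((hasDerivWithinAt_id t (Ici t)).const_mul a⁻¹).smul_const (D.flow s a v))
    have h2 := h1.congr_of_eventuallyEq (f₁ := D.curve s v) (by
      filter_upwards [Icc_mem_nhdsGE hta] with x hx
      exact D.curve_of_le s v hx.2) (D.curve_of_le s v hta.le)
    rw [norm_smul, D.hγa, Real.norm_eq_abs, abs_of_nonneg (mul_nonneg (inv_nonneg.2 D.ha.1.le) hs)]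
    rw [D.flow_init, smul_smul, Prod.smul_mk, smul_eq_mul] at h2
    exact h2
  · have hta' := not_lt.1 hta
    have h1 := (D.isFlowLine s t ⟨hta', ht.2.le⟩ v).Ici_of_Icc ⟨hta', ht.2⟩
    have h2 := h1.congr (f₁ := D.curve s v) (fun x hx => D.curve_of_ge s v (hta'.trans hx))
      (D.curve_of_ge s v hta')
    rw [norm_smul, Real.norm_of_nonneg (speed_nonneg D.hδ.le _ _)]
    rw [Prod.smul_mk, smul_eq_mul] at h2
    exact h2

lemma curve_zero (s : V → ℝ) (v : V) : D.curve s v 0 = 0 := by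
  rw [D.curve_of_le s v D.ha.1.le, mul_zero, zero_smul]

lemma pathLength_curve {s : V → ℝ} {v : V} (hs : 0 ≤ s v) {t : ℝ} (ht : t ∈ Icc (0 : ℝ) 1) :
    pathLength (fun t => (D.curve s v t).2) t = (D.curve s v t).1 := by
  obtain ⟨φ, hφ⟩ := D.exists_hasDerivWithinAt_curve hs
  exact pathLength_snd_eq_fst (D.continuousOn_curve s v) hφ (by rw [D.curve_zero]; rfl) ht

lemma liftedPoint_curve {s : V → ℝ} {v : V} (hs : 0 ≤ s v) {t : ℝ} (ht : t ∈ Icc (0 : ℝ) 1) :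
    liftedPoint (fun t => (D.curve s v t).2) t = WithLp.toLp 2 (D.curve s v t) := by
  rw [liftedPoint, D.pathLength_curve hs ht]

lemma flow_root {s : V → ℝ} (hs : s T.root = 1) {t : ℝ} (ht : t ∈ Icc a 1) :
    D.flow s t T.root = (ρ + lengthFrom γ a t, γ t) := by
  have h := (D.isFlowLine s).root_eq D.hasDerivWithinAt_length D.hasDerivWithinAt_path ht
  rw [D.flow_init, hs, one_smul, lengthFrom_self, sub_zero, sub_eq_iff_eq_add] at h
  rw [h, Prod.mk_add_mk, sub_add_cancel, add_comm]

lemma curve_root_snd {s : V → ℝ} (hs : s T.root = 1) :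
    EqOn (fun t => (D.curve s T.root t).2) γ (Icc 0 1) := by
  intro t ht
  rcases le_total t a with hta | hta
  · simp only [D.curve_of_le s _ hta]
    rw [D.flow_init, hs, one_smul, D.hrad t ⟨ht.1, hta⟩, mul_comm (γ a)]
    exact Complex.real_smul
  · simp only [D.curve_of_ge s _ hta, D.flow_root hs ⟨hta, ht.2⟩]

lemma Icc_subset : Icc a 1 ⊆ Icc 0 1 := Icc_subset_Icc_left D.ha.1.le

lemma liftedPoint_path {s : V → ℝ} (hs : s T.root = 1) {t : ℝ} (ht : t ∈ Icc a 1) :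
    liftedPoint γ t = WithLp.toLp 2 (D.flow s t T.root) := by
  have ht' := D.Icc_subset ht
  rw [← D.curve_of_ge s _ ht.1, ← D.liftedPoint_curve (hs ▸ zero_le_one) ht', liftedPoint,
    liftedPoint, show (D.curve s T.root t).2 = γ t from D.curve_root_snd hs ht',
    pathLength_congr ((D.curve_root_snd hs).mono (Icc_subset_Icc_right ht'.2))]

lemma pathLength_path {t : ℝ} (ht : t ∈ Icc a 1) : pathLength γ t = ρ + lengthFrom γ a t := by
  have h := D.liftedPoint_path (s := fun _ => 1) rfl ht
  rw [D.flow_root rfl ht] at h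
  exact congrArg (fun z : WithLp 2 (ℝ × ℂ) => z.fst) h

/-- At the root the origin is at distance at least `ρ ≥ δ` by the first coordinate, and the singular
set at distance at least `δ` because `γ` is in `Π^{δ,L}`. -/
lemma height_le_eta {s : V → ℝ} (hs : s T.root = 1) (v : V) :
    ∀ t ∈ Icc a 1, T.height Ω δ v (D.flow s t) ≤ (T.dfsAt Ω v).eta (D.flow s t v) := by
  intro t ht
  by_cases hv : v = T.root
  · subst hv
    rw [height_root]
    refine (Metric.le_infDist (DFS.pointedSet_nonempty _)).2 ?_
    rintro p (rfl | hp)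
    · rw [dist_zero_right]
      refine le_trans ?_ (norm_le_norm_toLp_two _)
      refine le_trans ?_ (norm_fst_le _)
      rw [D.flow_root hs ht, Real.norm_eq_abs]
      exact le_trans (by linarith [D.hδρ, lengthFrom_nonneg (γ := γ) ht.1]) (le_abs_self _)
    · have h1 := D.hdist t (D.Icc_subset ht)
      rw [D.liftedPoint_path hs ht] at h1
      have h2 := h1.trans (Metric.infEDist_le_edist_of_mem (subset_closure hp))
      rw [edist_dist] at h2
      exact (ENNReal.ofReal_le_ofReal_iff dist_nonneg).1 h2
  · exact (height_of_ne hv _).le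

/-- Singular points lie above level `2ρ`, while the radial segment stays at levels up to `ρ`. -/
lemma le_norm_init_sub {s : V → ℝ} {v : V} (hs : s v ∈ Icc (0 : ℝ) 1) {c : ℝ}
    (hc : c ∈ Icc (0 : ℝ) 1) {p : WithLp 2 (ℝ × ℂ)} (hp : p ∈ (T.dfsAt Ω v).singSet) :
    ρ ≤ ‖c • D.flow s a v - p.ofLp‖ := by
  have h1 : 2 * ρ < p.fst := Ω.lt_fst_of_mem_singSet_convPow D.hρΩ hp
  refine le_trans ?_ (norm_fst_le _)
  rw [Real.norm_eq_abs, Prod.fst_sub, abs_sub_comm]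
  refine le_trans ?_ (le_abs_self _)
  rw [D.flow_init]
  change ρ ≤ p.fst - c * (s v * ρ)
  have : c * (s v * ρ) ≤ 1 * (1 * ρ) := by
    have := D.hρ.le
    have := hs.1
    gcongr
    exacts [hc.2, hs.2]
  linarith

lemma inv_mul_mem {t : ℝ} (ht : t ∈ Icc 0 a) : a⁻¹ * t ∈ Icc (0 : ℝ) 1 :=
  ⟨mul_nonneg (inv_nonneg.2 D.ha.1.le) ht.1, (inv_mul_le_one₀ D.ha.1).2 ht.2⟩

lemma lengthFrom_mono {t t' : ℝ} (ht : a ≤ t) (htt' : t ≤ t') (ht' : t' ≤ 1) :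
    lengthFrom γ a t ≤ lengthFrom γ a t' := by
  have hsub : Icc t t' ⊆ Icc a 1 := Icc_subset_Icc ht ht'
  have h := image_le_of_deriv_right_le_deriv_boundary (a := t) (b := t')
    (f := fun _ => lengthFrom γ a t) (f' := fun _ => 0) (B := lengthFrom γ a)
    (B' := fun t => ‖derivWithin γ (Icc a 1) t‖) continuousOn_const
    (fun x _ => hasDerivWithinAt_const x _ _) le_rfl
    (fun x hx => (D.hasDerivWithinAt_length x (hsub hx)).continuousWithinAt.mono hsub)
    (fun x hx => (D.hasDerivWithinAt_length x (hsub (Ico_subset_Icc_self hx))).Ici_of_Icc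
      ⟨ht.trans hx.1, hx.2.trans_le ht'⟩) (fun _ _ => norm_nonneg _) ⟨htt', le_rfl⟩
  exact h

lemma le_norm_curve_sub {s : V → ℝ} (hs : s ∈ T.box) (v : V) {t t₀ : ℝ} (ht₀ : t₀ ∈ Icc a 1)
    (ht : t ∈ Icc 0 t₀) {p : WithLp 2 (ℝ × ℂ)} (hp : p ∈ (T.dfsAt Ω v).singSet) :
    ρ * Real.exp (-(2 * √2 * δ⁻¹ * lengthFrom γ a t₀)) ≤ ‖D.curve s v t - p.ofLp‖ := by
  have hδ := D.hδ
  have hρ := D.hρ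
  have hL := lengthFrom_nonneg (γ := γ) ht₀.1
  rcases le_total t a with hta | hta
  · rw [D.curve_of_le s v hta]
    refine le_trans ?_ (D.le_norm_init_sub (hs.1 v) (D.inv_mul_mem ⟨ht.1, hta⟩) hp)
    exact mul_le_of_le_one_right hρ.le (Real.exp_le_one_iff.2 (neg_nonpos.2 (by positivity)))
  · have ht' : t ∈ Icc a 1 := ⟨hta, ht.2.trans ht₀.2⟩
    rw [D.curve_of_ge s v hta]
    refine le_trans ?_ ((D.isFlowLine s).mul_exp_le_norm_sub D.hδ D.hasDerivWithinAt_length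
      (D.height_le_eta hs.2 v) (mem_insert_of_mem 0 hp) ht')
    have h0 := D.le_norm_init_sub (hs.1 v) (right_mem_Icc.2 zero_le_one) hp
    rw [one_smul] at h0
    have h1 := D.lengthFrom_mono hta ht.2 ht₀.2
    rw [lengthFrom_self, mul_zero, sub_zero]
    -- Grönwall gives the rate `√2 δ⁻¹`; the rate `2√2 δ⁻¹` in the claim is weaker.
    have h2 : 0 ≤ √2 * δ⁻¹ * lengthFrom γ a t₀ := by positivity
    have h3 : √2 * δ⁻¹ * lengthFrom γ a t ≤ √2 * δ⁻¹ * lengthFrom γ a t₀ :=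
      mul_le_mul_of_nonneg_left h1 (by positivity)
    exact mul_le_mul h0 (Real.exp_le_exp.2 (by linarith)) (Real.exp_pos _).le (norm_nonneg _)

lemma exists_norm_flow_sub_le : ∃ C : ℝ, 0 ≤ C ∧ ∀ s s', ∀ t ∈ Icc a 1,
    ‖D.flow s t - D.flow s' t‖ ≤ C * ‖s - s'‖ := by
  obtain ⟨C, hC, h⟩ := IsFlowLine.exists_norm_indicator_sub_le T Ω D.hδ D.continuousOn_derivWithin
    D.ha.2.le
  have hρ := D.hρ
  refine ⟨C * ρ, by positivity, fun s s' t ht => ?_⟩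
  have h1 := h univ (fun _ _ => subset_univ _) _ _ (D.isFlowLine s) (D.isFlowLine s') t ht
  simp only [indicator_univ] at h1
  refine h1.trans ?_
  rw [mul_assoc]
  gcongr
  refine (pi_norm_le_iff_of_nonneg (by positivity)).2 fun v => ?_
  rw [Pi.sub_apply, D.flow_init, D.flow_init, ← sub_smul, norm_smul, D.norm_init, mul_comm]
  gcongr
  exact norm_le_pi_norm (s - s') v

lemma exists_norm_flow_sub_le_time : ∃ M : ℝ, 0 ≤ M ∧ ∀ s v, ∀ t ∈ Icc a 1, ∀ t' ∈ Icc a 1,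
    ‖D.flow s t v - D.flow s t' v‖ ≤ M * |t - t'| := by
  obtain ⟨M, hM⟩ := isCompact_Icc.exists_bound_of_continuousOn D.continuousOn_derivWithin
  refine ⟨M, (norm_nonneg _).trans (hM a (left_mem_Icc.2 D.ha.2.le)), fun s v t ht t' ht' => ?_⟩
  refine (convex_Icc a 1).norm_image_sub_le_of_norm_hasDerivWithin_le
    (fun x hx => D.isFlowLine s x hx v) (fun x hx => ?_) ht' ht
  rw [norm_smul_norm_prodMk, abs_of_nonneg (speed_nonneg D.hδ.le _ _)]
  exact (mul_le_of_le_one_left (norm_nonneg _) (speed_le_one D.hδ.le _ _)).trans (hM x hx)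

/-- Joint Lipschitz continuity of the flow in the time and the parameters. -/
lemma exists_lipschitzOnWith_flow (v : V) : ∃ K : ℝ≥0,
    LipschitzOnWith K (fun q : ℝ × (V → ℝ) => D.flow q.2 q.1 v) (Icc a 1 ×ˢ univ) := by
  obtain ⟨C, hC, h⟩ := D.exists_norm_flow_sub_le
  obtain ⟨M, hM, h'⟩ := D.exists_norm_flow_sub_le_time
  refine ⟨(M + C).toNNReal, LipschitzOnWith.of_dist_le_mul ?_⟩
  rintro ⟨t, s⟩ ⟨ht, -⟩ ⟨t', s'⟩ ⟨ht', -⟩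
  rw [Real.coe_toNNReal _ (by positivity)]
  refine (dist_triangle _ (D.flow s t' v) _).trans ?_
  rw [add_mul, dist_eq_norm, dist_eq_norm]
  refine add_le_add ((h' s v t ht t' ht').trans ?_) (le_trans ?_ ((h s s' t' ht').trans ?_))
  · gcongr
    exact le_max_left _ _
  · exact norm_le_pi_norm (D.flow s t' - D.flow s' t') v
  · rw [← dist_eq_norm]
    gcongr
    exact le_max_right _ _

lemma continuousOn_curve_prod (v : V) :
    ContinuousOn (fun q : ℝ × (V → ℝ) => D.curve q.2 v q.1) (Icc 0 1 ×ˢ univ) := by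
  rw [D.Icc_zero_one_eq, union_prod]
  refine ContinuousOn.union_of_isClosed ?_ ?_ (isClosed_Icc.prod isClosed_univ)
    (isClosed_Icc.prod isClosed_univ)
  · refine ContinuousOn.congr
      (f := fun q : ℝ × (V → ℝ) => (a⁻¹ * q.1) • (q.2 v • ((ρ, γ a) : ℝ × ℂ)))
      (by fun_prop) fun q hq => ?_
    rw [D.curve_of_le _ v hq.1.2, D.flow_init]
  · obtain ⟨K, hK⟩ := D.exists_lipschitzOnWith_flow v
    exact hK.continuousOn.congr fun q hq => D.curve_of_ge _ v hq.1.1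

lemma exists_lipschitzOnWith_curve (s : V → ℝ) (v : V) :
    ∃ K : ℝ≥0, LipschitzOnWith K (D.curve s v) (Icc 0 1) := by
  obtain ⟨M, hM, h⟩ := D.exists_norm_flow_sub_le_time
  set C := a⁻¹ * ‖D.flow s a v‖ with hC
  have hC0 : 0 ≤ C := mul_nonneg (inv_nonneg.2 D.ha.1.le) (norm_nonneg _)
  have h1 : ∀ x ∈ Icc 0 a, ∀ y ∈ Icc 0 a, ‖D.curve s v x - D.curve s v y‖ ≤ C * |x - y| := by
    intro x hx y hy
    rw [D.curve_of_le s v hx.2, D.curve_of_le s v hy.2, ← sub_smul, ← mul_sub, norm_smul,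
      norm_mul, Real.norm_of_nonneg (inv_nonneg.2 D.ha.1.le), Real.norm_eq_abs, hC]
    exact le_of_eq (by ring)
  have h2 : ∀ x ∈ Icc a 1, ∀ y ∈ Icc a 1, ‖D.curve s v x - D.curve s v y‖ ≤ M * |x - y| := by
    intro x hx y hy
    rw [D.curve_of_ge s v hx.1, D.curve_of_ge s v hy.1]
    exact h s v x hx y hy
  refine ⟨(C + M).toNNReal, LipschitzOnWith.of_dist_le_mul fun x hx y hy => ?_⟩
  rw [Real.coe_toNNReal _ (by positivity), dist_eq_norm, Real.dist_eq]
  wlog hxy : x ≤ y generalizing x y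
  · rw [norm_sub_rev, abs_sub_comm]
    exact this y hy x hx (le_of_not_ge hxy)
  have hxy0 := abs_nonneg (x - y)
  rcases le_total y a with hya | hya
  · exact (h1 x ⟨hx.1, hxy.trans hya⟩ y ⟨hy.1, hya⟩).trans (by gcongr; linarith)
  rcases le_total a x with hxa | hxa
  · exact (h2 x ⟨hxa, hx.2⟩ y ⟨hya, hy.2⟩).trans (by gcongr; linarith)
  have e1 := h1 x ⟨hx.1, hxa⟩ a ⟨D.ha.1.le, le_rfl⟩
  have e2 := h2 a ⟨le_rfl, D.ha.2.le⟩ y ⟨hya, hy.2⟩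
  have e3 : |x - a| ≤ |x - y| := by
    rw [abs_sub_comm, abs_sub_comm x, abs_of_nonneg (by linarith), abs_of_nonneg (by linarith)]
    linarith
  have e4 : |a - y| ≤ |x - y| := by
    rw [abs_sub_comm, abs_sub_comm x, abs_of_nonneg (by linarith), abs_of_nonneg (by linarith)]
    linarith
  have e5 := norm_sub_le_norm_sub_add_norm_sub (D.curve s v x) (D.curve s v a) (D.curve s v y)
  rw [add_mul]
  exact e5.trans (add_le_add (e1.trans (by gcongr)) (e2.trans (by gcongr)))

/-- The restrictions of the curves are allowed, with explicit bounds. -/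
lemma curve_mem_allowedPathsIn {s : V → ℝ} (hs : s ∈ T.box) (v : V) {t₀ : ℝ}
    (ht₀ : t₀ ∈ Icc a 1) :
    (fun τ => (D.curve s v (t₀ * τ)).2) ∈ (T.dfsAt Ω v).allowedPathsIn
      (ρ * Real.exp (-(2 * √2 * δ⁻¹ * lengthFrom γ a t₀))) (D.curve s v t₀).1 := by
  have ht₀pos : 0 < t₀ := D.ha.1.trans_le ht₀.1
  have hmaps : ∀ τ ∈ Icc (0 : ℝ) 1, t₀ * τ ∈ Icc 0 t₀ := fun τ hτ =>
    ⟨mul_nonneg ht₀pos.le hτ.1, mul_le_of_le_one_right ht₀pos.le hτ.2⟩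
  have hmaps' : ∀ τ ∈ Icc (0 : ℝ) 1, t₀ * τ ∈ Icc (0 : ℝ) 1 := fun τ hτ =>
    Icc_subset_Icc_right ht₀.2 (hmaps τ hτ)
  have hlen : ∀ τ ∈ Icc (0 : ℝ) 1, pathLength (fun τ => (D.curve s v (t₀ * τ)).2) τ =
      (D.curve s v (t₀ * τ)).1 := fun τ hτ => by
    rw [pathLength_comp_mul (fun t => (D.curve s v t).2) ht₀pos,
      D.pathLength_curve (hs.1 v).1 (hmaps' τ hτ)]
  have hdist : ∀ τ ∈ Icc (0 : ℝ) 1,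
      ENNReal.ofReal (ρ * Real.exp (-(2 * √2 * δ⁻¹ * lengthFrom γ a t₀))) ≤
        Metric.infEDist (liftedPoint (fun τ => (D.curve s v (t₀ * τ)).2) τ)
          (closure (T.dfsAt Ω v).singSet) := by
    intro τ hτ
    rw [Metric.infEDist_closure]
    refine Metric.le_infEDist.2 fun p hp => ?_
    rw [edist_dist]
    refine ENNReal.ofReal_le_ofReal ?_
    rw [liftedPoint, hlen τ hτ, dist_eq_norm]
    refine (D.le_norm_curve_sub hs v ht₀ (hmaps τ hτ) hp).trans ?_
    exact norm_le_norm_toLp_two (D.curve s v (t₀ * τ) - p.ofLp)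
  refine ⟨⟨⟨?_, ?_⟩, fun τ hτ hmem => ?_⟩, fun τ hτ => ⟨hdist τ hτ, ?_⟩⟩
  · obtain ⟨K, hK⟩ := D.exists_lipschitzOnWith_curve s v
    have h1 : LipschitzWith 1 (Prod.snd : ℝ × ℂ → ℂ) := LipschitzWith.prod_snd
    have h2 : LipschitzWith t₀.toNNReal (fun τ => t₀ * τ) :=
      LipschitzWith.of_dist_le_mul fun x y => by
        rw [Real.coe_toNNReal _ ht₀pos.le, Real.dist_eq, Real.dist_eq, ← mul_sub, abs_mul,
          abs_of_pos ht₀pos]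
    exact ⟨_, h1.comp_lipschitzOnWith (hK.comp h2.lipschitzOnWith hmaps')⟩
  · simp only [mul_zero, D.curve_zero, Prod.snd_zero]
  · have h := hdist τ hτ
    rw [Metric.infEDist_zero_of_mem hmem, nonpos_iff_eq_zero, ENNReal.ofReal_eq_zero] at h
    exact absurd h (not_le.2 (mul_pos D.hρ (Real.exp_pos _)))
  · rw [hlen τ hτ]
    have h1 := hmaps τ hτ
    have h2 := Icc_subset_Icc_right ht₀.2 (right_mem_Icc.2 ht₀pos.le)
    rw [← D.pathLength_curve (hs.1 v).1 (hmaps' τ hτ), ← D.pathLength_curve (hs.1 v).1 h2]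
    obtain ⟨K, hK⟩ := D.exists_lipschitzOnWith_curve s v
    have hfin : eVariationOn (fun t => (D.curve s v t).2) (Icc 0 t₀) ≠ ⊤ := by
      have h3 := (LipschitzWith.prod_snd (α := ℝ) (β := ℂ)).comp_lipschitzOnWith hK
      have h4 := h3.comp_boundedVariationOn (g := id) (s := Icc (0 : ℝ) 1) (mapsTo_id _)
        (BoundedVariationOn.id_Icc 0 1)
      exact h4.mono (Icc_subset_Icc_right ht₀.2)
    exact ENNReal.toReal_mono hfin (eVariationOn.mono _ (Icc_subset_Icc_right h1.2))

lemma curve_mem_allowedPaths {s : V → ℝ} (hs : s ∈ T.box) (v : V) :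
    (fun τ => (D.curve s v τ).2) ∈ (T.dfsAt Ω v).allowedPaths := by
  have h := (D.curve_mem_allowedPathsIn hs v (right_mem_Icc.2 D.ha.2.le)).1
  simpa only [one_mul] using h

end DeformationData

end IterationDiagram

/-! ### The deformation, its image and its Jacobian -/

namespace IterationDiagram

variable {V : Type*} [Fintype V]

lemma update_extend [DecidableEq V] (T : IterationDiagram V) (x : T.Inner → ℝ) (u : T.Inner)
    (r : ℝ) : T.extend (Function.update x u r) = Function.update (T.extend x) u r := by
  funext v
  by_cases hv : v = T.root
  · have : v ≠ u := fun h => u.2 (h ▸ hv)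
    simp [extend, hv, Function.update_of_ne (hv ▸ this)]
  · by_cases hu : v = u
    · subst hu
      simp [extend, u.2]
    · have : (⟨v, hv⟩ : T.Inner) ≠ u := fun h => hu (congrArg Subtype.val h)
      simp [extend, hv, Function.update_of_ne hu, Function.update_of_ne this]

lemma extend_root (T : IterationDiagram V) (x : T.Inner → ℝ) : T.extend x T.root = 1 := dif_pos rfl

lemma extend_inner (T : IterationDiagram V) (x : T.Inner → ℝ) (u : T.Inner) :
    T.extend x u = x u := dif_neg u.2

lemma norm_extend_sub_le [DecidableEq V] (T : IterationDiagram V) (x y : T.Inner → ℝ) :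
    ‖T.extend x - T.extend y‖ ≤ ‖x - y‖ := by
  refine (pi_norm_le_iff_of_nonneg (norm_nonneg _)).2 fun v => ?_
  by_cases hv : v = T.root
  · rw [Pi.sub_apply, hv, extend_root, extend_root, sub_self, norm_zero]
    exact norm_nonneg _
  · have := norm_le_pi_norm (x - y) ⟨v, hv⟩
    rwa [Pi.sub_apply, ← T.extend_inner x ⟨v, hv⟩, ← T.extend_inner y ⟨v, hv⟩] at this

namespace DeformationData

variable {T : IterationDiagram V} {Ω : DFS} {ρ δ : ℝ} {γ : ℝ → ℂ} {a : ℝ}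
  (D : DeformationData T Ω ρ δ γ a) (X : ∀ v, EndlessSurface.{u} (T.dfsAt Ω v))

/-- The deformation given by the lifts of the curves. -/
noncomputable def deformation (t : ℝ) (s : V → ℝ) (v : V) : (X v).carrier :=
  (X v).lift (fun τ => (D.curve s v τ).2) t

include D

lemma proj_deformation {t : ℝ} (ht : t ∈ Icc a 1) {s : V → ℝ} (hs : s ∈ T.box) (v : V) :
    (X v).proj (D.deformation X t s v) = (D.flow s t v).2 := by
  rw [deformation, ((X v).lift_spec (D.curve_mem_allowedPaths hs v)).2.2 t (D.Icc_subset ht),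
    D.curve_of_ge s v ht.1]

/-- Points of `compactum` are end points at time `1`, so the curve up to time `t` is reparametrised.
-/
lemma lift_one_eq_deformation {t : ℝ} (ht : t ∈ Icc a 1) {s : V → ℝ} (hs : s ∈ T.box) (v : V) :
    (X v).lift (fun τ => (D.curve s v (t * τ)).2) 1 = D.deformation X t s v :=
  (X v).lift_comp_mul (D.curve_mem_allowedPaths hs v) (D.Icc_subset ht)
    (D.curve_mem_allowedPathsIn hs v ht).1

lemma flow_eq_of_depSet {s s' : V → ℝ} {v : V} (h : ∀ u ∈ T.depSet v, s u = s' u) {t : ℝ}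
    (ht : t ∈ Icc a 1) : D.flow s t v = D.flow s' t v :=
  (D.isFlowLine s).eq_of_depSet D.hδ D.continuousOn_derivWithin (D.isFlowLine s')
    (fun u hu => by rw [D.flow_init, D.flow_init, h u hu]) ht

lemma curve_eq_of_depSet {s s' : V → ℝ} {v : V} (h : ∀ u ∈ T.depSet v, s u = s' u) :
    EqOn (D.curve s v) (D.curve s' v) (Icc 0 1) := by
  intro t ht
  rcases le_total t a with hta | hta
  · rw [D.curve_of_le s v hta, D.curve_of_le s' v hta,
      D.flow_eq_of_depSet h (left_mem_Icc.2 D.ha.2.le)]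
  · rw [D.curve_of_ge s v hta, D.curve_of_ge s' v hta, D.flow_eq_of_depSet h ⟨hta, ht.2⟩]

theorem isAdaptedDeformation : IsAdaptedDeformation Ω T X γ a (D.deformation X) where
  initial s hs v := by
    have ha : a ∈ Icc a 1 := left_mem_Icc.2 D.ha.2.le
    have hs' := T.simplex_subset_box hs
    rw [← D.lift_one_eq_deformation X ha hs' v]
    refine (X v).lift_congr (D.curve_mem_allowedPathsIn hs' v ha).1 (fun τ hτ => ?_)
      (right_mem_Icc.2 zero_le_one)
    have h1 : a * τ ≤ a := mul_le_of_le_one_right D.ha.1.le hτ.2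
    simp only [D.curve_of_le s v h1, D.flow_init, inv_mul_cancel_left₀ D.ha.1.ne', Prod.smul_mk,
      Complex.real_smul]
  continuousOn := by
    refine continuousOn_pi.2 fun v => ?_
    refine ((X v).continuousOn_lift (F := fun s τ => (D.curve s v τ).2) (S := T.box) ?_
      fun s hs => D.curve_mem_allowedPaths hs v).mono
      (prod_mono D.Icc_subset T.simplex_subset_box)
    exact ((D.continuousOn_curve_prod v).mono (prod_mono le_rfl (subset_univ _))).snd
  locallyLipschitz v := by
    obtain ⟨K, hK⟩ := D.exists_lipschitzOnWith_flow v
    have h2 := (LipschitzWith.prod_snd (α := ℝ) (β := ℂ)).comp_lipschitzOnWith hK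
    intro q hq
    refine ⟨1 * K, _, self_mem_nhdsWithin, fun x hx y hy => ?_⟩
    dsimp only
    rw [D.proj_deformation X hx.1 (T.simplex_subset_box hx.2),
      D.proj_deformation X hy.1 (T.simplex_subset_box hy.2)]
    exact h2 ⟨hx.1, mem_univ _⟩ ⟨hy.1, mem_univ _⟩
  dependsOn t ht v s hs s' hs' h :=
    (X v).lift_congr (D.curve_mem_allowedPaths (T.simplex_subset_box hs) v)
      (fun τ hτ => congrArg Prod.snd (D.curve_eq_of_depSet h hτ)) (D.Icc_subset ht)
  root t ht s hs :=
    (X T.root).lift_congr (D.curve_mem_allowedPaths (T.simplex_subset_box hs) T.root)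
      (D.curve_root_snd hs.2.2) (D.Icc_subset ht)
  face_zero t ht v hv s hs h0 := by
    have h1 : D.flow s a v = 0 := by rw [D.flow_init, h0, zero_smul]
    have h2 : ∀ τ ∈ Icc (0 : ℝ) 1, (D.curve s v τ).2 = 0 := by
      intro τ hτ
      rcases le_total τ a with hτa | hτa
      · rw [D.curve_of_le s v hτa, h1, smul_zero, Prod.snd_zero]
      · rw [D.curve_of_ge s v hτa, (D.isFlowLine s).eq_zero D.hδ D.hasDerivWithinAt_length hv h1
          ⟨hτa, hτ.2⟩, Prod.snd_zero]
    exact ((X v).lift_unique (D.curve_mem_allowedPaths (T.simplex_subset_box hs) v)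
      (g := fun _ => (X v).base) continuousOn_const rfl
      (fun τ hτ => by rw [(X v).proj_base, h2 τ hτ]) (D.Icc_subset ht)).symm
  face_sum t ht v hv s hs h0 := by
    have hs' := T.simplex_subset_box hs
    have h1 := (D.isFlowLine s).sum_children_eq D.hδ D.hasDerivWithinAt_length hv
      (D.height_le_eta hs'.2 v) (by
        simp only [D.flow_init]
        rw [← Finset.sum_smul, h0]) ht
    simp only [D.proj_deformation X ht hs']
    rw [← h1, Prod.snd_sum]

lemma image_deformation_subset {t : ℝ} (ht : t ∈ Icc a 1) :
    D.deformation X t '' T.simplex ⊆ ⋃ s ∈ T.simplex, univ.pi fun v =>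
      (X v).compactum (ρ * Real.exp (-(2 * √2 * δ⁻¹ * lengthFrom γ a t)))
        (s v * pathLength γ t) := by
  rintro _ ⟨s, hs, rfl⟩
  have hs' := T.simplex_subset_box hs
  have hρ := D.hρ
  have hpos : 0 < ρ + lengthFrom γ a t := by linarith [lengthFrom_nonneg (γ := γ) ht.1]
  -- The witness is not the original `s` but the vector of lengths at time `t`, normalised by the
  -- length of `γ|_t`.
  refine mem_iUnion₂.2 ⟨fun v => (D.flow s t v).1 / (ρ + lengthFrom γ a t), ⟨fun v => ?_,
    fun v => ?_, ?_⟩, fun v _ => ⟨_, ?_, D.lift_one_eq_deformation X ht hs' v⟩⟩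
  · refine div_nonneg (le_trans ?_ ((D.isFlowLine s).fst_le_fst D.hδ v ht)) hpos.le
    rw [D.flow_init]
    exact mul_nonneg (hs.1 v) hρ.le
  · rw [← Finset.sum_div]
    refine div_le_div_of_nonneg_right ?_ hpos.le
    refine (D.isFlowLine s).sum_fst_le D.hδ v ?_ ht
    simp only [D.flow_init, Prod.smul_mk, smul_eq_mul]
    rw [← Finset.sum_mul]
    gcongr
    exact hs.2.1 v
  · dsimp only
    rw [D.flow_root hs.2.2 ht, div_self hpos.ne']
  · rw [D.pathLength_path ht, div_mul_cancel₀ _ hpos.ne', ← D.curve_of_ge s v ht.1]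
    exact D.curve_mem_allowedPathsIn hs' v ht

/-- The `ℓ¹` estimate for the siblings of `u` when only the coordinate at `u` varies. -/
lemma sum_norm_flow_update_sub_le [DecidableEq V] {s : V → ℝ} {u : V} (hu : u ≠ T.root) (r : ℝ)
    {t : ℝ} (ht : t ∈ Icc a 1) :
    ∑ v ∈ T.children (T.parent u), ‖(D.flow (Function.update s u r) t v).2 - (D.flow s t v).2‖ ≤
      ρ * Real.exp (2 * √2 * δ⁻¹ * lengthFrom γ a t) * |r - s u| := by
  have h := (D.isFlowLine (Function.update s u r)).sum_norm_sub_le D.hδ D.continuousOn_derivWithin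
    D.hasDerivWithinAt_length (D.isFlowLine s) (v := T.parent u) (fun w hw => ?_) ht
  · refine (Finset.sum_le_sum fun v _ => norm_snd_le
      (D.flow (Function.update s u r) t v - D.flow s t v)).trans (h.trans_eq ?_)
    rw [Finset.sum_eq_single_of_mem u (T.mem_children.2 ⟨hu, rfl⟩), lengthFrom_self, mul_zero,
      sub_zero, D.flow_init, D.flow_init, Function.update_self, ← sub_smul, norm_smul,
      D.norm_init, Real.norm_eq_abs]
    · ring
    · intro w _ hwu
      rw [D.flow_init, D.flow_init, Function.update_of_ne hwu, sub_self, norm_zero]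
  · have hwu : w ≠ u := by
      rintro rfl
      exact T.notMem_depSet_parent hu rfl hw
    rw [D.flow_init, D.flow_init, Function.update_of_ne hwu]

/-- The Jacobian estimate at a point of differentiability. -/
lemma norm_det_le [DecidableEq V] {t : ℝ} (ht : t ∈ Icc a 1) {x : T.Inner → ℝ}
    {J : Matrix T.Inner T.Inner ℂ}
    (hJ : ∀ v u : T.Inner, HasDerivAt
      (fun r : ℝ => (D.flow (T.extend (Function.update x u r)) t v).2) (J v u) (x u)) :
    ‖J.det‖ ≤ (ρ * Real.exp (3 * δ⁻¹ * lengthFrom γ a t)) ^ (Fintype.card V - 1) := by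
  have hρ := D.hρ
  have hδ := D.hδ
  have hzero : ∀ v u : T.Inner, (u : V) ∉ T.depSet v → J v u = 0 := by
    intro v u huv
    refine (hJ v u).unique ((hasDerivAt_const (x u) (D.flow (T.extend x) t v).2).congr_of_eventuallyEq
      (Filter.Eventually.of_forall fun r => ?_))
    dsimp only
    rw [T.update_extend, D.flow_eq_of_depSet (fun w hw => ?_) ht]
    refine Function.update_of_ne ?_ _ _
    rintro rfl
    exact huv hw
  refine (Matrix.norm_det_le_prod_sum_of_level J (fun v => T.depth v) fun v u h =>
    T.depth_le_of_mem_depSet (by_contra fun hn => h (hzero v u hn))).trans ?_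
  have hcol : ∀ u : T.Inner, ∑ v ∈ Finset.univ.filter (fun v : T.Inner => T.depth v = T.depth u),
      ‖J v u‖ ≤ ρ * Real.exp (3 * δ⁻¹ * lengthFrom γ a t) := by
    intro u
    have hsib : ∑ v ∈ Finset.univ.filter (fun v : T.Inner => T.depth v = T.depth u), ‖J v u‖ ≤
        ∑ v ∈ Finset.univ.filter (fun v : T.Inner => T.parent v = T.parent u), ‖J v u‖ := by
      rw [← Finset.sum_filter_ne_zero]
      refine Finset.sum_le_sum_of_subset_of_nonneg (fun v hv => ?_) fun _ _ _ => norm_nonneg _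
      rw [Finset.mem_filter, Finset.mem_filter] at hv
      rw [Finset.mem_filter]
      obtain ⟨hv, hne⟩ := hv
      have hmem : (u : V) ∈ T.depSet v :=
        by_contra fun hn => hne (by rw [hzero v u hn, norm_zero])
      exact ⟨hv.1, T.parent_eq_of_mem_depSet hmem u.2 hv.2⟩
    -- The `ℓ¹` bound holds for difference quotients in the single variable `s_u` and passes to the
    -- limit.
    have hlim : Filter.Tendsto (fun r : ℝ =>
        ∑ v ∈ Finset.univ.filter (fun v : T.Inner => T.parent v = T.parent u),
          ‖slope (fun r : ℝ => (D.flow (T.extend (Function.update x u r)) t v).2) (x u) r‖)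
        (nhdsWithin (x u) {x u}ᶜ)
        (nhds (∑ v ∈ Finset.univ.filter (fun v : T.Inner => T.parent v = T.parent u), ‖J v u‖)) :=
      tendsto_finsetSum _ fun v _ => (hJ v u).tendsto_slope.norm
    have hbound : ∑ v ∈ Finset.univ.filter (fun v : T.Inner => T.parent v = T.parent u), ‖J v u‖ ≤
        ρ * Real.exp (2 * √2 * δ⁻¹ * lengthFrom γ a t) := by
      refine le_of_tendsto hlim (eventually_mem_nhdsWithin.mono fun r hr => ?_)
      have hr' : 0 < |r - x u| := abs_pos.2 (sub_ne_zero.2 hr)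
      have h := D.sum_norm_flow_update_sub_le (s := T.extend x) u.2 r ht
      rw [T.extend_inner] at h
      simp only [slope_def_module, norm_smul, norm_inv, Real.norm_eq_abs, T.update_extend]
      rw [← Finset.mul_sum, inv_mul_le_iff₀ hr', mul_comm]
      refine le_trans (le_of_eq ?_) h
      rw [← T.extend_inner x u, Function.update_eq_self]
      refine Finset.sum_bij (fun v _ => (v : V)) (fun v hv => ?_) (fun v _ w _ h => Subtype.ext h)
        (fun v hv => ?_) (fun v _ => rfl)
      · exact T.mem_children.2 ⟨v.2, (Finset.mem_filter.1 hv).2⟩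
      · obtain ⟨h1, h2⟩ := T.mem_children.1 hv
        exact ⟨⟨v, h1⟩, Finset.mem_filter.2 ⟨Finset.mem_univ _, h2⟩, rfl⟩
    refine hsib.trans (hbound.trans ?_)
    have hL := lengthFrom_nonneg (γ := γ) ht.1
    -- The origin of the constant `3` in `c(t)`.
    have h2 : 2 * √2 ≤ 3 := by
      nlinarith [Real.sq_sqrt (zero_le_two (α := ℝ)), Real.sqrt_nonneg 2]
    gcongr
  refine (Finset.prod_le_prod (fun u _ => by positivity) fun u _ => hcol u).trans_eq ?_
  rw [Finset.prod_const, Finset.card_univ]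
  congr 1
  exact Set.card_ne_eq T.root

/-- The flow is defined and Lipschitz for all real parameters, so Rademacher's theorem applies on
the whole space. -/
lemma ae_exists_jacobian [DecidableEq V] {t : ℝ} (ht : t ∈ Icc a 1) :
    ∀ᵐ x : T.Inner → ℝ, T.extend x ∈ T.simplex →
      ∃ J : Matrix T.Inner T.Inner ℂ,
        (∀ v u : T.Inner, HasDerivAt
          (fun r : ℝ => (X v).proj (D.deformation X t (T.extend (Function.update x u r)) v))
          (J v u) (x u)) ∧
        ‖J.det‖ ≤ (ρ * Real.exp (3 * δ⁻¹ * lengthFrom γ a t)) ^ (Fintype.card V - 1) := by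
  obtain ⟨C, hC, hCle⟩ := D.exists_norm_flow_sub_le
  have hlip : LipschitzWith C.toNNReal
      (fun x : T.Inner → ℝ => fun v : T.Inner => (D.flow (T.extend x) t v).2) := by
    refine LipschitzWith.of_dist_le_mul fun x y => ?_
    rw [dist_eq_norm, dist_eq_norm, Real.coe_toNNReal _ hC]
    refine (pi_norm_le_iff_of_nonneg (by positivity)).2 fun v => ?_
    refine (norm_snd_le (D.flow (T.extend x) t v - D.flow (T.extend y) t v)).trans ?_
    refine (norm_le_pi_norm (D.flow (T.extend x) t - D.flow (T.extend y) t) v).trans ?_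
    refine (hCle _ _ t ht).trans ?_
    gcongr
    exact T.norm_extend_sub_le x y
  -- Discarding the null sets where a coordinate is `0` or `1` keeps small variations of one
  -- coordinate in the box, where the projected deformation equals the flow.
  have hne : ∀ c : ℝ, ∀ᵐ x : T.Inner → ℝ, ∀ v, x v ≠ c := fun c =>
    MeasureTheory.ae_all_iff.2 fun v => by
      rw [MeasureTheory.volume_pi]
      exact MeasureTheory.Measure.ae_eval_ne (α := fun _ => ℝ) (fun _ => MeasureTheory.volume) v c
  filter_upwards [hlip.ae_differentiableAt, hne 0, hne 1] with x hx hx0 hx1 hmem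
  have hIoo : ∀ v, x v ∈ Ioo (0 : ℝ) 1 := fun v => by
    have h := (T.simplex_subset_box hmem).1 v
    rw [T.extend_inner] at h
    exact ⟨lt_of_le_of_ne h.1 (hx0 v).symm, lt_of_le_of_ne h.2 (hx1 v)⟩
  have hbox : ∀ u, ∀ᶠ r in nhds (x u), T.extend (Function.update x u r) ∈ T.box := by
    intro u
    filter_upwards [Ioo_mem_nhds (hIoo u).1 (hIoo u).2] with r hr
    refine ⟨fun v => ?_, T.extend_root _⟩
    rw [T.update_extend]
    by_cases hv : v = u
    · rw [hv, Function.update_self]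
      exact Ioo_subset_Icc_self hr
    · rw [Function.update_of_ne hv]
      exact (T.simplex_subset_box hmem).1 v
  have hd : ∀ v u : T.Inner, HasDerivAt
      (fun r : ℝ => (D.flow (T.extend (Function.update x u r)) t v).2)
      (fderiv ℝ (fun x : T.Inner → ℝ => fun v : T.Inner => (D.flow (T.extend x) t v).2) x
        (Pi.single u 1) v) (x u) := by
    intro v u
    have h1 : HasDerivAt (fun r => Function.update x u r) (Pi.single u (1 : ℝ)) (x u) :=
      hasDerivAt_update x u (x u)
    have h2 := hx.hasFDerivAt
    rw [← Function.update_eq_self u x] at h2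
    have h3 := h2.comp_hasDerivAt (x u) h1
    rw [Function.update_eq_self] at h3
    exact hasDerivAt_pi.1 h3 v
  refine ⟨Matrix.of fun v u => _, fun v u => ?_, D.norm_det_le ht hd⟩
  refine (hd v u).congr_of_eventuallyEq ?_
  filter_upwards [hbox u] with r hr
  exact D.proj_deformation X ht hr v

end DeformationData

end IterationDiagram

theorem theorem4p6 {V : Type*} [Fintype V] [DecidableEq V]
    (T : IterationDiagram V) (Ω : DFS)
    -- the `X v` are arbitrary `Ω_v`-endless Riemann surfaces, e.g. the universal ones
    (X : ∀ v, EndlessSurface.{u} (T.dfsAt Ω v))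
    (ρ : ℝ) (hρ : 0 < ρ) (hρΩ : ENNReal.ofReal (2 * ρ) < Ω.rho)
    (δ L : ℝ) (hδ : 0 < δ) (hδρ : δ ≤ ρ) (hL : 0 < L)
    (γ : ℝ → ℂ) (hγ : γ ∈ (T.dfsAt Ω T.root).allowedPathsIn δ L)
    (a : ℝ) (ha : a ∈ Set.Ioo (0 : ℝ) 1)
    (hC1 : ContDiffOn ℝ 1 γ (Set.Icc a 1)) (hγa : ‖γ a‖ = ρ)
    (hrad : ∀ t ∈ Set.Icc 0 a, γ t = γ a * ((a⁻¹ * t : ℝ) : ℂ)) :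
    ∃ Ψ : ℝ → (V → ℝ) → ∀ v, (X v).carrier,
      IsAdaptedDeformation Ω T X γ a Ψ ∧
      (∀ t ∈ Set.Icc a 1,
        Ψ t '' T.simplex ⊆ ⋃ s ∈ T.simplex, Set.univ.pi fun v =>
          (X v).compactum (ρ * Real.exp (-(2 * √2 * δ⁻¹ * lengthFrom γ a t)))
            (s v * pathLength γ t)) ∧
      (∀ t ∈ Set.Icc a 1, ∀ᵐ x : T.Inner → ℝ, T.extend x ∈ T.simplex →
        ∃ J : Matrix T.Inner T.Inner ℂ,
          (∀ v u : T.Inner, HasDerivAt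
            (fun r : ℝ => (X v).proj (Ψ t (T.extend (Function.update x u r)) v)) (J v u) (x u)) ∧
          ‖J.det‖ ≤ (ρ * Real.exp (3 * δ⁻¹ * lengthFrom γ a t)) ^ (Fintype.card V - 1)) := by
  have D : IterationDiagram.DeformationData T Ω ρ δ γ a :=
    ⟨hρ, hρΩ, hδ, hδρ, fun t ht => (hγ.2 t ht).1, ha, hC1, hγa, hrad⟩
  exact ⟨D.deformation X, D.isAdaptedDeformation X, fun t ht => D.image_deformation_subset X ht,
    fun t ht => D.ae_exists_jacobian X ht⟩
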